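/- Let $d\ge 1$, let $A,B\in\mathbb R^{d\times d}$, let $\lambda_0,\lambda\in\mathbb R^d$ with $\lambda\ge\lambda_0\ge 0$ componentwise, and let $\nu_1,\dots,\nu_d$ be probability measures on $\mathbb R$ with $\int x^2\,\nu_k(dx)<\infty$. On a filtered probability space let $0<T_1<T_2<\cdots$ be (possibly infinite) event times with $T_n\to\infty$, with types $X_n\in\{1,\dots,d\}$ and non-negative jump sizes $Y_n^k$; put $N_k(t)=\sum_n 1_{\{X_n=k,\,T_n\le t\}}$ and $U_k(t)=\sum_n Y_n^k 1_{\{X_n=k,\,T_n\le t\}}$. Let the $[0,\infty)^d$-valued adapted process $\lambda(t)$ satisfy $$d\lambda(t)=A(\lambda(t)-\lambda_0)\,dt+B\,dU(t),\qquad \lambda(0)=\lambda,$$ where $N_k$ is adapted and has intensity $\lambda_k(t)$, that is, $\mathbb E_\lambda\int_0^\infty f(s)\,dN_k(s)=\mathbb E_\lambda\int_0^\infty f(s)\lambda_k(s)\,ds$ for all non-negative predictable $f$, and where the jump laws are homogeneous: on $\{T_n<\infty\}$, given the strict past of $T_n$ and $X_n=k$, the jump size $Y_n^k$ has law $\nu_k$.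 (Here $\mathbb E_\lambda$ is expectation for the process started at $\lambda$.) Let $J$ be the diagonal matrix with entries $\int x\,\nu_k(dx)$, $k=1,\dots,d$, let $M=A+BJ$, $y(t)=\mathbb E_\lambda[\lambda(t)]$ and $V(t)=\mathbb E_\lambda[\lambda(t)\lambda(t)^\top]$; for $y\in\mathbb R^d$ let $\Xi_2(y)$ be the diagonal matrix with entries $y_k\int x^2\,\nu_k(dx)$, and let $$F(t)=-y(t)\lambda_0^\top A^\top-A\lambda_0\,y(t)^\top+B\,\Xi_2(y(t))\,B^\top .$$ Then $y(t)$ and $V(t)$ are finite for all $t\ge 0$, $V$ satisfies the differential Sylvester equation $$V'(t)=MV(t)+V(t)M^\top+F(t),\qquad t\ge 0$$ (one-sided derivative at $t=0$), and for all $t\ge0$ $$V(t)=e^{tM}\left(\lambda\lambda^\top+\int_0^t e^{-sM}F(s)e^{-sM^\top}\,ds\right)e^{tM^\top}.$$ -/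

import Mathlib

open MeasureTheory ProbabilityTheory Matrix Set Filter
open scoped NNReal ENNReal Topology Matrix

noncomputable section

/-- The sigma-algebra of events strictly prior to the random time `τ`: it is generated by `𝓕 0`
and by the sets `A ∩ {t < τ}` with `A ∈ 𝓕 t`. -/
@[reducible] def strictPast {Ω : Type*} {mΩ : MeasurableSpace Ω} (𝓕 : Filtration ℝ≥0 mΩ)
    (τ : Ω → ℝ≥0∞) : MeasurableSpace Ω :=
  MeasurableSpace.generateFrom
    ({S | MeasurableSet[𝓕 0] S} ∪
      {S | ∃ (t : ℝ≥0) (A : Set Ω), MeasurableSet[𝓕 t] A ∧ S = A ∩ {ω | (t : ℝ≥0∞) < τ ω}})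

/-- The counting process `N_k(t) = ∑ₙ 1{X_n = k, T_n ≤ t}` of component `k`.  The events are
indexed by `n = 0, 1, 2, …`, so `T 0` is the time of the first event; the value `T n ω = ∞`
means that there are at most `n` events. -/
def countingProcess {Ω : Type*} {d : ℕ} (T : ℕ → Ω → ℝ≥0∞) (X : ℕ → Ω → Fin d)
    (k : Fin d) (t : ℝ≥0) (ω : Ω) : ℝ≥0∞ :=
  ∑' n, if X n ω = k ∧ T n ω ≤ (t : ℝ≥0∞) then 1 else 0

/-- The Stieltjes integral `∫_0^∞ f(s) dN_k(s) = ∑ₙ 1{X_n = k, T_n < ∞} f(T_n)`. -/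
def countingIntegral {Ω : Type*} {d : ℕ} (T : ℕ → Ω → ℝ≥0∞) (X : ℕ → Ω → Fin d)
    (k : Fin d) (f : ℝ≥0 × Ω → ℝ≥0∞) (ω : Ω) : ℝ≥0∞ :=
  ∑' n, if X n ω = k ∧ T n ω ≠ ∞ then f ((T n ω).toNNReal, ω) else 0

/-- The accumulated jumps `U_k(t) = ∑ₙ 1{X_n = k, T_n ≤ t} Y_n^k` of all components `k`. -/
def jumpProcess {Ω : Type*} {d : ℕ} (T : ℕ → Ω → ℝ≥0∞) (X : ℕ → Ω → Fin d)
    (Y : ℕ → Fin d → Ω → ℝ) (t : ℝ≥0) (ω : Ω) : Fin d → ℝ :=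
  fun k => ∑' n, if X n ω = k ∧ T n ω ≤ (t : ℝ≥0∞) then Y n k ω else 0

/-- A multivariate SDE-driven self-exciting jump process on a filtered probability space, with
drift `μ`, excitation matrix `B`, jump-size laws `ν k (x, ·)`, and intensity process `L` started
at `x₀`:
* `(T n, X n)` is a simple, locally finite `d`-dimensional point process;
* each counting process `N_k` is adapted and has the (nonnegative, adapted) intensity `L_k`, i.e.
  `E ∫ f dN_k = E ∫ f(s) L_k(s) ds` for all nonnegative predictable `f`;
* at an event of type `k` at time `T n`, the jump size `Y n k ≥ 0` has the conditional law
  `ν k (L(T_n-), ·)` given the strict past of `T n` and `X n = k`;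
* `dL(t) = μ(t, L(t)) dt + B dU(t)`, `L(0) = x₀`. -/
structure IsSelfExcitingJumpProcess {Ω : Type*} {mΩ : MeasurableSpace Ω} (P : Measure Ω)
    (𝓕 : Filtration ℝ≥0 mΩ) {d : ℕ} (μ : ℝ → (Fin d → ℝ) → (Fin d → ℝ))
    (B : Matrix (Fin d) (Fin d) ℝ) (ν : Fin d → Kernel (Fin d → ℝ) ℝ) (x₀ : Fin d → ℝ)
    (T : ℕ → Ω → ℝ≥0∞) (X : ℕ → Ω → Fin d) (Y : ℕ → Fin d → Ω → ℝ)
    (L : ℝ≥0 → Ω → (Fin d → ℝ)) : Prop where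
  measurable_time : ∀ n, Measurable (T n)
  measurable_type : ∀ n, Measurable (X n)
  measurable_size : ∀ n k, Measurable (Y n k)
  time_pos : ∀ ω, 0 < T 0 ω
  time_mono : ∀ ω, Monotone (fun n => T n ω)
  time_strict : ∀ n ω, T n ω ≠ ∞ → T n ω < T (n + 1) ω
  nonexplosive : ∀ ω, Tendsto (fun n => T n ω) atTop (𝓝 ∞)
  size_nonneg : ∀ n k ω, 0 ≤ Y n k ω
  counting_adapted : ∀ k, Adapted 𝓕 (countingProcess T X k)
  intensity_adapted : Adapted 𝓕 L
  intensity_nonneg : ∀ t ω k, 0 ≤ L t ω k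
  intensity : ∀ (k : Fin d) (f : ℝ≥0 × Ω → ℝ≥0∞), Measurable[𝓕.predictable] f →
    ∫⁻ ω, countingIntegral T X k f ω ∂P
      = ∫⁻ ω, (∫⁻ s in Ici (0 : ℝ), f (s.toNNReal, ω) * ENNReal.ofReal (L s.toNNReal ω k)) ∂P
  size_law : ∀ (n : ℕ) (k : Fin d) (A : Set Ω) (C : Set ℝ),
    MeasurableSet[strictPast 𝓕 (T n)] A → MeasurableSet C →
    P (A ∩ {ω | X n ω = k ∧ T n ω ≠ ∞} ∩ {ω | Y n k ω ∈ C})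
      = ∫⁻ ω in A ∩ {ω | X n ω = k ∧ T n ω ≠ ∞},
          ν k (Function.leftLim (fun t => L t ω) (T n ω).toNNReal) C ∂P
  drift_integrable : ∀ (t : ℝ≥0) ω,
    IntervalIntegrable (fun s : ℝ => μ s (L s.toNNReal ω)) volume 0 t
  sde : ∀ (t : ℝ≥0) ω,
    L t ω = x₀ + (∫ s in (0 : ℝ)..t, μ s (L s.toNNReal ω)) + B *ᵥ jumpProcess T X Y t ω

/-- The mean vector `y(t) = E[L(t)]`. -/
def meanVector {Ω : Type*} {mΩ : MeasurableSpace Ω} (P : Measure Ω) {d : ℕ}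
    (L : ℝ≥0 → Ω → (Fin d → ℝ)) (t : ℝ) : Fin d → ℝ :=
  fun i => ∫ ω, L t.toNNReal ω i ∂P

/-- The second-moment matrix `V(t) = E[L(t) L(t)ᵀ]`. -/
def secondMoment {Ω : Type*} {mΩ : MeasurableSpace Ω} (P : Measure Ω) {d : ℕ}
    (L : ℝ≥0 → Ω → (Fin d → ℝ)) (t : ℝ) : Matrix (Fin d) (Fin d) ℝ :=
  Matrix.of fun i j => ∫ ω, L t.toNNReal ω i * L t.toNNReal ω j ∂P

/-- `M = A + B J`, where `J` is the diagonal matrix of the mean jump sizes `∫ x ν_k(dx)`. -/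
def meanMatrix {d : ℕ} (A B : Matrix (Fin d) (Fin d) ℝ) (ν : Fin d → Measure ℝ) :
    Matrix (Fin d) (Fin d) ℝ :=
  A + B * Matrix.diagonal fun k => ∫ x, x ∂(ν k)

/-- `Ξ₂(y)`, the diagonal matrix with entries `y_k ∫ x² ν_k(dx)`. -/
def jumpSecondMoment {d : ℕ} (ν : Fin d → Measure ℝ) (y : Fin d → ℝ) :
    Matrix (Fin d) (Fin d) ℝ :=
  Matrix.diagonal fun k => y k * ∫ x, x ^ 2 ∂(ν k)

/-- `-y l₀ᵀ Aᵀ - A l₀ yᵀ + B Ξ₂(y) Bᵀ`, the inhomogeneity of the Sylvester equation. -/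
def sylvesterSource {d : ℕ} (A B : Matrix (Fin d) (Fin d) ℝ) (l₀ : Fin d → ℝ)
    (ν : Fin d → Measure ℝ) (y : Fin d → ℝ) : Matrix (Fin d) (Fin d) ℝ :=
  -(vecMulVec y l₀ * Aᵀ) - vecMulVec (A *ᵥ l₀) y + B * jumpSecondMoment ν y * Bᵀ

/-- The entrywise integral `∫_a^b G(s) ds` of a matrix-valued function. -/
def matrixIntegral {d : ℕ} (G : ℝ → Matrix (Fin d) (Fin d) ℝ) (a b : ℝ) :
    Matrix (Fin d) (Fin d) ℝ :=
  Matrix.of fun i j => ∫ s in a..b, G s i j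

end

/-! ### Products of piecewise absolutely continuous paths -/

/-! Along each path the intensity is an absolutely continuous function plus finitely many jumps on
bounded time intervals. The product formula for such paths (`jumpPath_mul_jumpPath`) writes `λᵢλⱼ`
as a drift integral plus a sum over events, where an event of type `k` and size `y` contributes
`(λᵢ₋ B j k + λⱼ₋ B i k) y + B i k B j k y²`.

Left limits are predictable and the marks are independent of the strict past, so the expectation of
such a sum is a `ds`-integral against `λ_k`, with `y` and `y²` replaced by the moments of `ν k`
(`lintegral_markedSum`, `integral_markedSum`). The result is quadratic in `λ`: its expectation is an
affine expression in `V(s)` and `y(s)`, namely `M V + V Mᵀ + F`. Hence `V` satisfies a closed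
integral equation (`dynkin`, `secondMoment_eq_integral`).

Taking expectations requires finite moments beforehand. `exists_moment_bound` supplies them: the
weight `1 + ∑ λᵢ²` is truncated to paths that have stayed below a level `m`, Gronwall's inequality
gives a bound independent of `m`, and Fatou's lemma removes the truncation.

Finally regularity is bootstrapped: `V` and `y` are primitives of integrable functions, hence
continuous; the right-hand side is then continuous, so `V` is differentiable. Conjugating `V` by the
matrix exponentials gives the explicit formula (`sylvester_variation_of_constants`). -/

theorem primitive_mul_primitive {a b : ℝ → ℝ} {t : ℝ} (x y : ℝ)
    (ha : IntervalIntegrable a volume 0 t) (hb : IntervalIntegrable b volume 0 t) :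
    (x + ∫ s in (0 : ℝ)..t, a s) * (y + ∫ s in (0 : ℝ)..t, b s) = x * y +
      ∫ s in (0 : ℝ)..t, (a s * (y + ∫ r in (0 : ℝ)..s, b r) +
        (x + ∫ r in (0 : ℝ)..s, a r) * b s) := by
  have h0 : (0 : ℝ) ∈ uIcc 0 t := left_mem_uIcc
  have hA := (ha.absolutelyContinuousOnInterval_intervalIntegral h0)
  have hB := (hb.absolutelyContinuousOnInterval_intervalIntegral h0)
  -- Integration by parts for absolutely continuous functions; by Lebesgue differentiation their
  -- derivatives are `a` and `b` almost everywhere.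
  have key : ∫ s in (0 : ℝ)..t, (a s * (∫ r in (0 : ℝ)..s, b r) +
      (∫ r in (0 : ℝ)..s, a r) * b s) = (∫ s in (0 : ℝ)..t, a s) * ∫ s in (0 : ℝ)..t, b s := by
    have h := hA.integral_deriv_mul_eq_sub hB
    simp only [intervalIntegral.integral_same, mul_zero, sub_zero] at h
    rw [← h]
    refine intervalIntegral.integral_congr_ae ?_
    filter_upwards [ha.ae_hasDerivAt_integral, hb.ae_hasDerivAt_integral] with s h1 h2 hs
    rw [(h1 (uIoc_subset_uIcc hs) 0 h0).deriv, (h2 (uIoc_subset_uIcc hs) 0 h0).deriv]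
  have hi1 : IntervalIntegrable (fun s => a s * (∫ r in (0 : ℝ)..s, b r) +
      (∫ r in (0 : ℝ)..s, a r) * b s) volume 0 t :=
    (ha.mul_continuousOn hB.continuousOn).add (hb.continuousOn_mul hA.continuousOn)
  have : (fun s => a s * (y + ∫ r in (0 : ℝ)..s, b r) + (x + ∫ r in (0 : ℝ)..s, a r) * b s) =
      fun s => (a s * (∫ r in (0 : ℝ)..s, b r) + (∫ r in (0 : ℝ)..s, a r) * b s) +
        (a s * y + x * b s) := by
    funext s; ring
  rw [this, intervalIntegral.integral_add hi1 ((ha.mul_const y).add (hb.const_mul x)), key,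
    intervalIntegral.integral_add (ha.mul_const y) (hb.const_mul x),
    intervalIntegral.integral_mul_const, intervalIntegral.integral_const_mul]
  ring

/-- The right-continuous path `x + ∫_0^s a + ∑_{τ n ≤ s} c n`. -/
noncomputable def jumpPath {ι : Type*} (x : ℝ) (a : ℝ → ℝ) (I : Finset ι) (τ c : ι → ℝ) (s : ℝ) :
    ℝ :=
  x + (∫ r in (0 : ℝ)..s, a r) + ∑ n ∈ I, if τ n ≤ s then c n else 0

/-- The left-continuous version `x + ∫_0^s a + ∑_{τ n < s} c n` of `jumpPath`. -/
noncomputable def jumpPathLeft {ι : Type*} (x : ℝ) (a : ℝ → ℝ) (I : Finset ι) (τ c : ι → ℝ)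
    (s : ℝ) : ℝ :=
  x + (∫ r in (0 : ℝ)..s, a r) + ∑ n ∈ I, if τ n < s then c n else 0

theorem integral_mul_step {b : ℝ → ℝ} {t u : ℝ} (hu : u ∈ Icc 0 t)
    (hb : IntervalIntegrable b volume 0 t) (c : ℝ) :
    IntervalIntegrable (fun s => (if u ≤ s then c else 0) * b s) volume 0 t ∧
    ∫ s in (0 : ℝ)..t, (if u ≤ s then c else 0) * b s = c * ∫ s in u..t, b s := by
  have heq : (fun s => (if u ≤ s then c else 0) * b s) = (Ici u).indicator fun s => c * b s := by
    funext s; by_cases h : u ≤ s <;> simp [h]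
  have h0u : IntervalIntegrable b volume 0 u :=
    hb.mono_set (uIcc_subset_uIcc_left (by rw [uIcc_of_le (hu.1.trans hu.2)]; exact hu))
  have hut : IntervalIntegrable b volume u t :=
    hb.mono_set (uIcc_subset_uIcc_right (by rw [uIcc_of_le (hu.1.trans hu.2)]; exact hu))
  have hint : IntervalIntegrable (fun s => (if u ≤ s then c else 0) * b s) volume 0 t := by
    rw [heq, intervalIntegrable_iff]
    exact ((hb.const_mul c).def').indicator measurableSet_Ici
  refine ⟨hint, ?_⟩
  have hsub : ∀ v w : ℝ, v ∈ Icc 0 t → w ∈ Icc 0 t →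
      IntervalIntegrable (fun s => (if u ≤ s then c else 0) * b s) volume v w := by
    intro v w hv hw
    refine hint.mono_set (uIcc_subset_uIcc ?_ ?_) <;> rw [uIcc_of_le (hu.1.trans hu.2)] <;>
      assumption
  have h0 : (0 : ℝ) ∈ Icc 0 t := ⟨le_rfl, hu.1.trans hu.2⟩
  have ht : t ∈ Icc 0 t := ⟨hu.1.trans hu.2, le_rfl⟩
  rw [← intervalIntegral.integral_add_adjacent_intervals (hsub 0 u h0 hu) (hsub u t hu ht)]
  have e1 : ∫ s in (0 : ℝ)..u, (if u ≤ s then c else 0) * b s = 0 := by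
    rw [intervalIntegral.integral_congr_ae (g := fun _ => 0)]
    · simp
    · have : ∀ᵐ s : ℝ, s ≠ u := by simp [ae_iff, measure_singleton]
      filter_upwards [this] with s hs hs'
      rw [uIoc_of_le hu.1] at hs'
      rw [if_neg (not_le.2 (lt_of_le_of_ne hs'.2 hs)), zero_mul]
  have e2 : ∫ s in u..t, (if u ≤ s then c else 0) * b s = c * ∫ s in u..t, b s := by
    rw [← intervalIntegral.integral_const_mul]
    refine intervalIntegral.integral_congr fun s hs => ?_
    rw [uIcc_of_le hu.2] at hs
    simp [hs.1]
  rw [e1, e2, zero_add]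

/-- The double sum over pairs `(m, n)` is split by whether `τ m` is before, equal to or after `τ n`;
injectivity makes ties exactly the diagonal, which becomes the bracket term `c n * e n`. -/
theorem sum_mul_sum_of_injOn {ι : Type*} (I : Finset ι) (τ c e : ι → ℝ)
    (hinj : InjOn τ (I : Set ι)) :
    (∑ n ∈ I, c n) * (∑ n ∈ I, e n) = ∑ n ∈ I, ((∑ m ∈ I, if τ m < τ n then c m else 0) * e n +
      (∑ m ∈ I, if τ m < τ n then e m else 0) * c n + c n * e n) := by
  classical
  have h1 : ∑ n ∈ I, (∑ m ∈ I, if τ m < τ n then e m else 0) * c n =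
      ∑ n ∈ I, (∑ m ∈ I, if τ n < τ m then c m else 0) * e n := by
    simp only [Finset.sum_mul]
    rw [Finset.sum_comm]
    refine Finset.sum_congr rfl fun n _ => Finset.sum_congr rfl fun m _ => ?_
    split_ifs <;> ring
  have h2 : ∑ n ∈ I, c n * e n = ∑ n ∈ I, (∑ m ∈ I, if m = n then c m else 0) * e n := by
    refine Finset.sum_congr rfl fun n hn => ?_
    simp [hn]
  rw [Finset.sum_add_distrib, Finset.sum_add_distrib, h1, h2, ← Finset.sum_add_distrib,
    ← Finset.sum_add_distrib, Finset.mul_sum]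
  refine Finset.sum_congr rfl fun n hn => ?_
  rw [← add_mul, ← add_mul, ← Finset.sum_add_distrib, ← Finset.sum_add_distrib]
  congr 1
  refine Finset.sum_congr rfl fun m hm => ?_
  rcases lt_trichotomy (τ m) (τ n) with h | h | h
  · have : m ≠ n := fun h' => by simp [h'] at h
    simp [h, this, not_lt.2 h.le]
  · have : m = n := hinj hm hn h
    simp [this]
  · have : m ≠ n := fun h' => by simp [h'] at h
    simp [h, this, not_lt.2 h.le]

/-- Pathwise Itô formula `d(fg) = f₋ dg + g₋ df + Δf Δg`. By bilinearity it reduces to three cases: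
two primitives, a step against a primitive, and two step functions. -/
theorem jumpPath_mul_jumpPath {ι : Type*} {a b : ℝ → ℝ} {t : ℝ} (x y : ℝ) (ht : 0 ≤ t)
    (ha : IntervalIntegrable a volume 0 t) (hb : IntervalIntegrable b volume 0 t)
    (I : Finset ι) (τ c e : ι → ℝ) (hτ : ∀ n ∈ I, τ n ∈ Icc 0 t) (hinj : InjOn τ (I : Set ι)) :
    jumpPath x a I τ c t * jumpPath y b I τ e t = x * y +
      (∫ s in (0 : ℝ)..t, (a s * jumpPath y b I τ e s + jumpPath x a I τ c s * b s)) +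
      ∑ n ∈ I, (jumpPathLeft x a I τ c (τ n) * e n + jumpPathLeft y b I τ e (τ n) * c n +
        c n * e n) := by
  have h0 : (0 : ℝ) ∈ uIcc 0 t := left_mem_uIcc
  have hA := (ha.absolutelyContinuousOnInterval_intervalIntegral h0).continuousOn
  have hB := (hb.absolutelyContinuousOnInterval_intervalIntegral h0).continuousOn
  have hi1 : IntervalIntegrable (fun s => a s * (y + ∫ r in (0 : ℝ)..s, b r) +
      (x + ∫ r in (0 : ℝ)..s, a r) * b s) volume 0 t :=
    (ha.mul_continuousOn (continuousOn_const.add hB)).add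
      (hb.continuousOn_mul (continuousOn_const.add hA))
  have hi2 : ∀ n ∈ I, IntervalIntegrable (fun s => (if τ n ≤ s then e n else 0) * a s)
      volume 0 t := fun n hn => (integral_mul_step (hτ n hn) ha _).1
  have hi3 : ∀ n ∈ I, IntervalIntegrable (fun s => (if τ n ≤ s then c n else 0) * b s)
      volume 0 t := fun n hn => (integral_mul_step (hτ n hn) hb _).1
  have hs2 : IntervalIntegrable (fun s => ∑ n ∈ I, (if τ n ≤ s then e n else 0) * a s)
      volume 0 t := by
    have h := IntervalIntegrable.sum I hi2
    rwa [Finset.sum_fn] at h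
  have hs3 : IntervalIntegrable (fun s => ∑ n ∈ I, (if τ n ≤ s then c n else 0) * b s)
      volume 0 t := by
    have h := IntervalIntegrable.sum I hi3
    rwa [Finset.sum_fn] at h
  have heq : (fun s => a s * jumpPath y b I τ e s + jumpPath x a I τ c s * b s) = fun s =>
      ((a s * (y + ∫ r in (0 : ℝ)..s, b r) + (x + ∫ r in (0 : ℝ)..s, a r) * b s) +
        ∑ n ∈ I, (if τ n ≤ s then e n else 0) * a s) +
        ∑ n ∈ I, (if τ n ≤ s then c n else 0) * b s := by
    funext s
    simp only [jumpPath, ← Finset.sum_mul]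
    ring
  have hsplit : ∀ {b : ℝ → ℝ}, IntervalIntegrable b volume 0 t → ∀ n ∈ I,
      ∫ s in (τ n)..t, b s = (∫ s in (0 : ℝ)..t, b s) - ∫ s in (0 : ℝ)..(τ n), b s := by
    intro b hb n hn
    rw [eq_sub_iff_add_eq, add_comm]
    refine intervalIntegral.integral_add_adjacent_intervals ?_ ?_
    · exact hb.mono_set (uIcc_subset_uIcc_left (by rw [uIcc_of_le ht]; exact hτ n hn))
    · exact hb.mono_set (uIcc_subset_uIcc_right (by rw [uIcc_of_le ht]; exact hτ n hn))
  have e2 : ∑ n ∈ I, e n * ∫ s in (τ n)..t, a s =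
      ∑ n ∈ I, (e n * (∫ s in (0 : ℝ)..t, a s) - e n * ∫ s in (0 : ℝ)..(τ n), a s) :=
    Finset.sum_congr rfl fun n hn => by rw [hsplit ha n hn]; ring
  have e3 : ∑ n ∈ I, c n * ∫ s in (τ n)..t, b s =
      ∑ n ∈ I, (c n * (∫ s in (0 : ℝ)..t, b s) - c n * ∫ s in (0 : ℝ)..(τ n), b s) :=
    Finset.sum_congr rfl fun n hn => by rw [hsplit hb n hn]; ring
  rw [heq, intervalIntegral.integral_add (hi1.add hs2) hs3, intervalIntegral.integral_add hi1 hs2,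
    intervalIntegral.integral_finsetSum hi2, intervalIntegral.integral_finsetSum hi3,
    Finset.sum_congr rfl fun n hn => (integral_mul_step (hτ n hn) ha (e n)).2,
    Finset.sum_congr rfl fun n hn => (integral_mul_step (hτ n hn) hb (c n)).2, e2, e3]
  have hc : ∀ c : ι → ℝ, ∑ n ∈ I, (if τ n ≤ t then c n else 0) = ∑ n ∈ I, c n := fun c =>
    Finset.sum_congr rfl fun n hn => if_pos (hτ n hn).2
  have hprod := primitive_mul_primitive x y ha hb
  have hUW := sum_mul_sum_of_injOn I τ c e hinj
  have hlast : ∑ n ∈ I, (jumpPathLeft x a I τ c (τ n) * e n + jumpPathLeft y b I τ e (τ n) * c n +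
        c n * e n) = x * (∑ n ∈ I, e n) + y * (∑ n ∈ I, c n) +
        ∑ n ∈ I, e n * (∫ s in (0 : ℝ)..(τ n), a s) +
        ∑ n ∈ I, c n * (∫ s in (0 : ℝ)..(τ n), b s) + (∑ n ∈ I, c n) * (∑ n ∈ I, e n) := by
    rw [hUW, Finset.mul_sum, Finset.mul_sum, ← Finset.sum_add_distrib, ← Finset.sum_add_distrib,
      ← Finset.sum_add_distrib, ← Finset.sum_add_distrib]
    refine Finset.sum_congr rfl fun n _ => ?_
    simp only [jumpPathLeft]
    ring
  rw [hlast]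
  simp only [Finset.sum_sub_distrib, ← Finset.sum_mul]
  simp only [jumpPath, hc]
  linear_combination hprod

/-! ### The differential Sylvester equation and an integral Gronwall inequality -/

theorem exp_smul_mul_exp_neg_smul {d : ℕ} (M : Matrix (Fin d) (Fin d) ℝ) (t : ℝ) :
    NormedSpace.exp (t • M) * NormedSpace.exp (-t • M) = 1 ∧
    NormedSpace.exp (-t • M) * NormedSpace.exp (t • M) = 1 := by
  constructor
  · rw [← Matrix.exp_add_of_commute _ _ (((Commute.refl M).smul_left t).smul_right (-t)), neg_smul,
      add_neg_cancel, NormedSpace.exp_zero]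
  · rw [← Matrix.exp_add_of_commute _ _ (((Commute.refl M).smul_left (-t)).smul_right t), neg_smul,
      neg_add_cancel, NormedSpace.exp_zero]

section Sylvester

attribute [local instance] Matrix.linftyOpNormedAddCommGroup Matrix.linftyOpNormedSpace
  Matrix.linftyOpNormedRing Matrix.linftyOpNormedAlgebra

/-- The operator norm is auxiliary, needed only for the calculus of the exponential. It induces the
product topology, so differentiation is entrywise. -/
theorem hasDerivWithinAt_matrix {d : ℕ} {V : ℝ → Matrix (Fin d) (Fin d) ℝ}
    {V' : Matrix (Fin d) (Fin d) ℝ} {s : Set ℝ} {t : ℝ}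
    (h : ∀ i j, HasDerivWithinAt (fun u => V u i j) (V' i j) s t) :
    HasDerivWithinAt V V' s t := by
  have := hasDerivWithinAt_pi.2 fun i => hasDerivWithinAt_pi.2 fun j => h i j
  exact this

theorem hasDerivWithinAt_entry {d : ℕ} {V : ℝ → Matrix (Fin d) (Fin d) ℝ}
    {V' : Matrix (Fin d) (Fin d) ℝ} {s : Set ℝ} {t : ℝ}
    (h : HasDerivWithinAt V V' s t) (i j : Fin d) :
    HasDerivWithinAt (fun u => V u i j) (V' i j) s t := by
  have : HasDerivWithinAt (V : ℝ → Fin d → Fin d → ℝ) V' s t := h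
  exact hasDerivWithinAt_pi.1 (hasDerivWithinAt_pi.1 this i) j

/-- For `W s = e^{-sM} V(s) e^{-sMᵀ}` the terms `M V` and `V Mᵀ` cancel in the derivative, leaving
`W' = e^{-sM} F e^{-sMᵀ}`, which is integrated directly. -/
theorem sylvester_variation_of_constants {d : ℕ} (M : Matrix (Fin d) (Fin d) ℝ)
    (V F : ℝ → Matrix (Fin d) (Fin d) ℝ)
    (hF : ∀ i j, ContinuousOn (fun s => F s i j) (Ici 0))
    (hV : ∀ t : ℝ, 0 ≤ t → HasDerivWithinAt V (M * V t + V t * Mᵀ + F t) (Ici 0) t)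
    (t : ℝ) (ht : 0 ≤ t) :
    (∀ i j, IntervalIntegrable
        (fun s => (NormedSpace.exp (-s • M) * F s * NormedSpace.exp (-s • Mᵀ)) i j) volume 0 t) ∧
    V t = NormedSpace.exp (t • M) * (V 0 + matrixIntegral
            (fun s => NormedSpace.exp (-s • M) * F s * NormedSpace.exp (-s • Mᵀ)) 0 t) *
          NormedSpace.exp (t • Mᵀ) := by
  -- Both forms of the derivative are needed: in `W` the factor `M` must stand next to `V`, thus to
  -- the right of the first exponential and to the left of the second.
  have hexp : ∀ M : Matrix (Fin d) (Fin d) ℝ, ∀ s : ℝ,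
      HasDerivAt (fun u : ℝ => NormedSpace.exp (-u • M)) (-(M * NormedSpace.exp (-s • M))) s := by
    intro M s
    have h := (hasDerivAt_exp_smul_const' (𝕂 := ℝ) M (-s)).scomp s (hasDerivAt_neg s)
    exact h.congr_deriv (neg_one_smul _ _)
  have hexp' : ∀ M : Matrix (Fin d) (Fin d) ℝ, ∀ s : ℝ,
      HasDerivAt (fun u : ℝ => NormedSpace.exp (-u • M)) (-(NormedSpace.exp (-s • M) * M)) s := by
    intro M s
    have h := (hasDerivAt_exp_smul_const (𝕂 := ℝ) M (-s)).scomp s (hasDerivAt_neg s)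
    exact h.congr_deriv (neg_one_smul _ _)
  have hcont : ∀ M : Matrix (Fin d) (Fin d) ℝ,
      Continuous (fun s : ℝ => NormedSpace.exp (-s • M)) := fun M =>
    continuous_iff_continuousAt.2 fun s => (hexp M s).continuousAt
  have hFc : ContinuousOn F (Ici 0) :=
    continuousOn_pi.2 fun i => continuousOn_pi.2 fun j => hF i j
  have hGc : ContinuousOn (fun s => NormedSpace.exp (-s • M) * F s * NormedSpace.exp (-s • Mᵀ))
      (Ici 0) := ((hcont M).continuousOn.mul hFc).mul (hcont Mᵀ).continuousOn
  have hGij : ∀ i j, ContinuousOn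
      (fun s => (NormedSpace.exp (-s • M) * F s * NormedSpace.exp (-s • Mᵀ)) i j) (Ici 0) :=
    fun i j => continuousOn_pi.1 (continuousOn_pi.1 hGc i) j
  have hsub : uIcc 0 t ⊆ Ici 0 := by rw [uIcc_of_le ht]; exact Icc_subset_Ici_self
  have hint : ∀ i j, IntervalIntegrable
        (fun s => (NormedSpace.exp (-s • M) * F s * NormedSpace.exp (-s • Mᵀ)) i j) volume 0 t :=
    fun i j => ((hGij i j).mono hsub).intervalIntegrable
  refine ⟨hint, ?_⟩
  set W : ℝ → Matrix (Fin d) (Fin d) ℝ := fun s =>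
    NormedSpace.exp (-s • M) * V s * NormedSpace.exp (-s • Mᵀ) with hW
  have hWd : ∀ s : ℝ, 0 ≤ s → HasDerivWithinAt W
      (NormedSpace.exp (-s • M) * F s * NormedSpace.exp (-s • Mᵀ)) (Ici 0) s := by
    intro s hs
    have h := (((hexp' M s).hasDerivWithinAt (s := Ici 0)).mul (hV s hs)).mul
      ((hexp Mᵀ s).hasDerivWithinAt (s := Ici 0))
    refine h.congr_deriv ?_
    simp only [Pi.mul_apply]
    noncomm_ring
  have hWt : W t = W 0 + matrixIntegral
      (fun s => NormedSpace.exp (-s • M) * F s * NormedSpace.exp (-s • Mᵀ)) 0 t := by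
    ext i j
    -- Continuity on `[0, t]` and right derivatives in the interior suffice, so nothing is required
    -- of `V` at negative times.
    have := intervalIntegral.integral_eq_sub_of_hasDeriv_right_of_le (f := fun s => W s i j) ht
      (fun s hs => (hasDerivWithinAt_entry (hWd s hs.1) i j).continuousWithinAt.mono
        Icc_subset_Ici_self)
      (fun s hs => (hasDerivWithinAt_entry (hWd s hs.1.le) i j).mono
        (fun r hr => hs.1.le.trans (le_of_lt hr))) (hint i j)
    simp only [matrixIntegral, Matrix.add_apply, Matrix.of_apply]
    rw [this]; ring
  have hinv : ∀ M : Matrix (Fin d) (Fin d) ℝ, NormedSpace.exp (t • M) * NormedSpace.exp (-t • M) = 1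
      ∧ NormedSpace.exp (-t • M) * NormedSpace.exp (t • M) = 1 := fun M =>
    exp_smul_mul_exp_neg_smul M t
  have hW0 : W 0 = V 0 := by simp [hW]
  rw [← hW0, ← hWt]
  calc V t = (NormedSpace.exp (t • M) * NormedSpace.exp (-t • M)) * V t *
        (NormedSpace.exp (-t • Mᵀ) * NormedSpace.exp (t • Mᵀ)) := by
        rw [(hinv M).1, (hinv Mᵀ).2, one_mul, mul_one]
    _ = _ := by simp only [hW, mul_assoc]

end Sylvester

/-- Gronwall by Picard iteration, without measurability or continuity of `u`. The a priori bound `m`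
only starts the iteration: after `n` rounds it contributes `m (Ct)ⁿ / n!`, which tends to zero. -/
theorem le_exp_of_le_add_lintegral {u : ℝ → ℝ≥0∞} {a C m : ℝ} (ha : 0 ≤ a) (hC : 0 ≤ C)
    (hm : 0 ≤ m) (hbdd : ∀ t, 0 ≤ t → u t ≤ ENNReal.ofReal m)
    (hu : ∀ t, 0 ≤ t → u t ≤ ENNReal.ofReal a + ENNReal.ofReal C * ∫⁻ s in Ioc 0 t, u s)
    (t : ℝ) (ht : 0 ≤ t) : u t ≤ ENNReal.ofReal (a * Real.exp (C * t)) := by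
  have key : ∀ n : ℕ, ∀ t, 0 ≤ t →
      u t ≤ ENNReal.ofReal (a * Real.exp (C * t) + m * ((C * t) ^ n / n.factorial)) := by
    intro n
    induction n with
    | zero =>
      intro t ht
      refine (hbdd t ht).trans (ENNReal.ofReal_le_ofReal ?_)
      simp; positivity
    | succ n ih =>
      intro t ht
      refine (hu t ht).trans ?_
      have hcont : Continuous fun s : ℝ =>
          a * Real.exp (C * s) + m * ((C * s) ^ n / n.factorial) := by fun_prop
      have h1 : ∫⁻ s in Ioc 0 t, u s ≤ ENNReal.ofReal
          (∫ s in (0 : ℝ)..t, (a * Real.exp (C * s) + m * ((C * s) ^ n / n.factorial))) := by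
        rw [intervalIntegral.integral_of_le ht, ofReal_integral_eq_lintegral_ofReal]
        · exact setLIntegral_mono' measurableSet_Ioc fun s hs => ih s hs.1.le
        · exact (hcont.integrableOn_Icc (a := 0) (b := t)).mono_set Ioc_subset_Icc_self
        · refine (ae_restrict_iff' measurableSet_Ioc).2 (ae_of_all _ fun s hs => ?_)
          have := hs.1.le
          simp only [Pi.zero_apply]; positivity
      have h2 : C * (∫ s in (0 : ℝ)..t, (a * Real.exp (C * s) + m * ((C * s) ^ n / n.factorial)))
          = (a * Real.exp (C * t) + m * ((C * t) ^ (n + 1) / (n + 1).factorial)) - a := by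
        have hd : ∀ s ∈ uIcc 0 t, HasDerivAt (fun s : ℝ =>
            a * Real.exp (C * s) + m * ((C * s) ^ (n + 1) / (n + 1).factorial))
            (C * (a * Real.exp (C * s) + m * ((C * s) ^ n / n.factorial))) s := by
          intro s _
          have hid : HasDerivAt (fun s : ℝ => C * s) C s := by
            simpa using (hasDerivAt_id s).const_mul C
          have := ((hid.exp).const_mul a).add
            (((hid.pow (n + 1)).div_const ((n + 1).factorial : ℝ)).const_mul m)
          refine this.congr_deriv ?_
          rw [Nat.factorial_succ]
          push_cast
          have : (n.factorial : ℝ) ≠ 0 := by positivity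
          have : (n + 1 : ℝ) ≠ 0 := by positivity
          field_simp
        rw [← intervalIntegral.integral_const_mul,
          intervalIntegral.integral_eq_sub_of_hasDerivAt hd
            ((continuous_const.mul hcont).intervalIntegrable _ _)]
        simp
      calc _ ≤ ENNReal.ofReal a + ENNReal.ofReal C * ENNReal.ofReal (∫ s in (0 : ℝ)..t,
            (a * Real.exp (C * s) + m * ((C * s) ^ n / n.factorial))) := by gcongr
        _ = _ := by
          have hn : 0 ≤ C * (∫ s in (0 : ℝ)..t,
              (a * Real.exp (C * s) + m * ((C * s) ^ n / n.factorial))) := by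
            refine mul_nonneg hC (intervalIntegral.integral_nonneg ht fun s hs => ?_)
            have := hs.1
            positivity
          rw [← ENNReal.ofReal_mul hC, ← ENNReal.ofReal_add ha hn, h2]
          congr 1; ring
  refine ge_of_tendsto' (x := atTop) (f := fun n : ℕ =>
    ENNReal.ofReal (a * Real.exp (C * t) + m * ((C * t) ^ n / n.factorial))) ?_
    fun n => key n t ht
  refine ENNReal.tendsto_ofReal ?_
  have := (FloorSemiring.tendsto_pow_div_factorial_atTop (C * t)).const_mul m
  simpa using this.const_add (a * Real.exp (C * t))

/-! ### Predictable integrands and the marked compensation formula -/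

section Predictable

variable {Ω : Type*} {mΩ : MeasurableSpace Ω}

theorem coe_lt_iff_lt_toNNReal_of_ne_top {a : ℝ≥0∞} {t : ℝ≥0} (ha : a ≠ ∞) :
    (t : ℝ≥0∞) < a ↔ t < a.toNNReal := by
  lift a to ℝ≥0 using ha
  simp

theorem strictPast_le {𝓕 : Filtration ℝ≥0 mΩ} {τ : Ω → ℝ≥0∞} (hτ : Measurable τ) :
    strictPast 𝓕 τ ≤ mΩ := by
  refine MeasurableSpace.generateFrom_le ?_
  rintro S (hS | ⟨t, A, hA, rfl⟩)
  · exact 𝓕.le 0 S hS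
  · exact (𝓕.le t A hA).inter (measurableSet_lt measurable_const hτ)

theorem predictable_le_prod (𝓕 : Filtration ℝ≥0 mΩ) :
    𝓕.predictable ≤ (inferInstance : MeasurableSpace (ℝ≥0 × Ω)) :=
  measurableSpace_le_predictable_of_measurableSet
    (fun A hA => (measurableSet_singleton _).prod (𝓕.le _ A hA))
    (fun i A hA => measurableSet_Ioi.prod (𝓕.le i A hA))

theorem measurableSet_strictPast_lt (𝓕 : Filtration ℝ≥0 mΩ) (τ : Ω → ℝ≥0∞) (t : ℝ≥0) :
    MeasurableSet[strictPast 𝓕 τ] {ω | (t : ℝ≥0∞) < τ ω} := by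
  refine MeasurableSpace.measurableSet_generateFrom (Or.inr ⟨t, univ, ?_, by simp⟩)
  exact @MeasurableSet.univ Ω (𝓕 t)

theorem measurableSet_strictPast_eq_top (𝓕 : Filtration ℝ≥0 mΩ) (τ : Ω → ℝ≥0∞) :
    MeasurableSet[strictPast 𝓕 τ] {ω | τ ω = ∞} := by
  have : {ω | τ ω = ∞} = ⋂ n : ℕ, {ω | ((n : ℝ≥0) : ℝ≥0∞) < τ ω} := by
    ext ω
    simp only [mem_ofPred_eq, mem_iInter, ENNReal.coe_natCast]
    constructor
    · intro h n; simp [h]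
    · intro h
      by_contra hne
      obtain ⟨n, hn⟩ := ENNReal.exists_nat_gt hne
      exact absurd (h n) (not_lt.2 hn.le)
  rw [this]
  exact @MeasurableSet.iInter Ω ℕ (strictPast 𝓕 τ) _ _
    fun n => measurableSet_strictPast_lt 𝓕 τ n

/-- The value of a predictable process at a random time is known in the strict past. -/
theorem measurable_strictPast_of_predictable {𝓕 : Filtration ℝ≥0 mΩ} {τ : Ω → ℝ≥0∞}
    {f : ℝ≥0 × Ω → ℝ≥0∞} (hf : Measurable[𝓕.predictable] f) :
    Measurable[strictPast 𝓕 τ]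
      (fun ω => if τ ω ≠ ∞ then f ((τ ω).toNNReal, ω) else 0) := by
  have hfin : MeasurableSet[strictPast 𝓕 τ] {ω | τ ω ≠ ∞} :=
    @MeasurableSet.compl Ω _ (strictPast 𝓕 τ) (measurableSet_strictPast_eq_top 𝓕 τ)
  -- On generators of the predictable sigma-algebra the preimages are `A ∩ {τ = 0}` and `A ∩ {t < τ
  -- < ∞}`, built from generators of the strict past. The condition `τ ω ≠ ∞` is kept throughout
  -- because `toNNReal` would send `∞` to time zero.
  have hset : ∀ S : Set (ℝ≥0 × Ω), MeasurableSet[𝓕.predictable] S →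
      MeasurableSet[strictPast 𝓕 τ] {ω | τ ω ≠ ∞ ∧ ((τ ω).toNNReal, ω) ∈ S} := by
    intro S hS
    induction S, hS using MeasurableSpace.generateFrom_induction with
    | hC S hS _ =>
      rcases hS with ⟨A, hA, rfl⟩ | ⟨t, A, hA, rfl⟩
      · have : {ω | τ ω ≠ ∞ ∧ ((τ ω).toNNReal, ω) ∈ ({⊥} : Set ℝ≥0) ×ˢ A} =
            A \ {ω | ((0 : ℝ≥0) : ℝ≥0∞) < τ ω} := by
          ext ω
          simp only [mem_ofPred_eq, mem_prod, mem_singleton_iff, Set.mem_sdiff, bot_eq_zero',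
            ENNReal.toNNReal_eq_zero_iff, ENNReal.coe_zero, not_lt, nonpos_iff_eq_zero]
          constructor
          · rintro ⟨h1, h2, h3⟩; exact ⟨h3, h2.resolve_right h1⟩
          · rintro ⟨h1, h2⟩; exact ⟨by simp [h2], Or.inl h2, h1⟩
        rw [this]
        refine @MeasurableSet.diff Ω (strictPast 𝓕 τ) _ _ ?_ (measurableSet_strictPast_lt 𝓕 τ 0)
        exact MeasurableSpace.measurableSet_generateFrom (Or.inl hA)
      · have : {ω | τ ω ≠ ∞ ∧ ((τ ω).toNNReal, ω) ∈ Ioi t ×ˢ A} =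
            {ω | τ ω ≠ ∞} ∩ (A ∩ {ω | (t : ℝ≥0∞) < τ ω}) := by
          ext ω
          simp only [mem_ofPred_eq, mem_prod, mem_Ioi, mem_inter_iff]
          constructor
          · rintro ⟨h1, h2, h3⟩
            exact ⟨h1, h3, (coe_lt_iff_lt_toNNReal_of_ne_top h1).2 h2⟩
          · rintro ⟨h1, h3, h2⟩
            exact ⟨h1, (coe_lt_iff_lt_toNNReal_of_ne_top h1).1 h2, h3⟩
        rw [this]
        refine @MeasurableSet.inter Ω (strictPast 𝓕 τ) _ _ hfin ?_
        exact MeasurableSpace.measurableSet_generateFrom (Or.inr ⟨t, A, hA, rfl⟩)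
    | empty => simp
    | compl S _ ih =>
      have : {ω | τ ω ≠ ∞ ∧ ((τ ω).toNNReal, ω) ∈ Sᶜ} =
          {ω | τ ω ≠ ∞} \ {ω | τ ω ≠ ∞ ∧ ((τ ω).toNNReal, ω) ∈ S} := by
        ext ω; simp only [mem_ofPred_eq, mem_compl_iff, Set.mem_sdiff]; tauto
      rw [this]
      exact @MeasurableSet.diff Ω (strictPast 𝓕 τ) _ _ hfin ih
    | iUnion S _ ih =>
      have : {ω | τ ω ≠ ∞ ∧ ((τ ω).toNNReal, ω) ∈ ⋃ i, S i} =
          ⋃ i, {ω | τ ω ≠ ∞ ∧ ((τ ω).toNNReal, ω) ∈ S i} := by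
        ext ω; simp
      rw [this]
      exact @MeasurableSet.iUnion Ω ℕ (strictPast 𝓕 τ) _ _ ih
  intro C hC
  have : (fun ω => if τ ω ≠ ∞ then f ((τ ω).toNNReal, ω) else 0) ⁻¹' C =
      {ω | τ ω ≠ ∞ ∧ ((τ ω).toNNReal, ω) ∈ f ⁻¹' C} ∪
        {ω | τ ω = ∞ ∧ (0 : ℝ≥0∞) ∈ C} := by
    ext ω
    by_cases h : τ ω = ∞ <;> simp [h]
  rw [this]
  refine @MeasurableSet.union Ω (strictPast 𝓕 τ) _ _ (hset _ (hf hC)) ?_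
  by_cases h0 : (0 : ℝ≥0∞) ∈ C
  · simpa [h0] using measurableSet_strictPast_eq_top 𝓕 τ
  · simp [h0]

/-- Left limits of an adapted process form a predictable process. -/
theorem measurable_predictable_of_left_limits {𝓕 : Filtration ℝ≥0 mΩ}
    {u v : ℝ≥0 → Ω → ℝ} (hu : ∀ t, Measurable[𝓕 t] (u t)) (h0 : v 0 = u 0)
    (hv : ∀ s ω, 0 < s → Tendsto (fun r => u r ω) (𝓝[<] s) (𝓝 (v s ω))) :
    Measurable[𝓕.predictable] (fun p : ℝ≥0 × Ω => v p.1 p.2) := by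
  -- `D n s / (n + 1)` is the last grid point strictly before `s`, so the approximants are constant
  -- on half-open intervals `(j/(n+1), (j+1)/(n+1)]` and use only earlier values of `u`. At `s = 0`
  -- truncated subtraction gives grid point zero.
  let D : ℕ → ℝ≥0 → ℕ := fun n s => ⌈s * (n + 1)⌉₊ - 1
  have hD : ∀ n : ℕ, Measurable[𝓕.predictable]
      (fun p : ℝ≥0 × Ω => u ((D n p.1 : ℝ≥0) / (n + 1)) p.2) := by
    intro n C hC
    have hpos : (0 : ℝ≥0) < n + 1 := by positivity
    have : (fun p : ℝ≥0 × Ω => u ((D n p.1 : ℝ≥0) / (n + 1)) p.2) ⁻¹' C =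
        ({⊥} ×ˢ (u 0 ⁻¹' C)) ∪
        ⋃ j : ℕ, Ioc ((j : ℝ≥0) / (n + 1)) ((j + 1 : ℝ≥0) / (n + 1)) ×ˢ
          (u ((j : ℝ≥0) / (n + 1)) ⁻¹' C) := by
      ext ⟨s, ω⟩
      simp only [mem_preimage, mem_union, mem_prod, mem_singleton_iff, mem_iUnion, mem_Ioc,
        bot_eq_zero']
      have hiff : ∀ j : ℕ, ((j : ℝ≥0) / (n + 1) < s ∧ s ≤ (j + 1 : ℝ≥0) / (n + 1)) ↔
          ⌈s * (n + 1)⌉₊ = j + 1 := by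
        intro j
        rw [Nat.ceil_eq_iff (by omega), div_lt_iff₀ hpos, le_div_iff₀ hpos]
        simp
      constructor
      · intro h
        rcases eq_or_ne s 0 with rfl | hs
        · left; simpa [D] using h
        · right
          have : 0 < ⌈s * (n + 1)⌉₊ := Nat.ceil_pos.2 (by positivity)
          refine ⟨⌈s * (n + 1)⌉₊ - 1, (hiff _).2 (by omega), h⟩
      · rintro (⟨rfl, h⟩ | ⟨j, hj, h⟩)
        · simpa [D] using h
        · have := (hiff j).1 hj
          simpa [D, this] using h
    rw [this]
    refine @MeasurableSet.union _ 𝓕.predictable _ _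
      (measurableSet_predictable_singleton_bot_prod (hu 0 hC)) ?_
    exact @MeasurableSet.iUnion _ _ 𝓕.predictable _ _ fun j =>
      measurableSet_predictable_Ioc_prod _ _ (hu _ hC)
  refine @measurable_of_tendsto_metrizable _ _ 𝓕.predictable _ _ _ _ _ _ hD ?_
  rw [tendsto_pi_nhds]
  rintro ⟨s, ω⟩
  rcases eq_or_ne s 0 with rfl | hs
  · simp [D, h0]
  · have hs0 : 0 < s := pos_iff_ne_zero.2 hs
    refine (hv s ω hs0).comp (tendsto_nhdsWithin_iff.2 ⟨?_, Eventually.of_forall fun n => ?_⟩)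
    · have hlow : ∀ n : ℕ, s - 1 / ((n : ℝ≥0) + 1) ≤ (D n s : ℝ≥0) / (n + 1) := by
        intro n
        have hpos : (0 : ℝ≥0) < n + 1 := by positivity
        rw [tsub_le_iff_right, ← add_div, le_div_iff₀ hpos]
        have h1 := Nat.le_ceil (s * (n + 1))
        have : 0 < ⌈s * (n + 1)⌉₊ := Nat.ceil_pos.2 (by positivity)
        have h2 : ((D n s : ℝ≥0) + 1) = ⌈s * (n + 1)⌉₊ := by
          have : D n s + 1 = ⌈s * (n + 1)⌉₊ := by simp only [D]; omega
          exact_mod_cast this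
        rw [h2]; exact h1
      have hup : ∀ n : ℕ, (D n s : ℝ≥0) / (n + 1) ≤ s := by
        intro n
        have hpos : (0 : ℝ≥0) < n + 1 := by positivity
        rw [div_le_iff₀ hpos]
        have : 0 < ⌈s * (n + 1)⌉₊ := Nat.ceil_pos.2 (by positivity)
        exact (Nat.lt_ceil.1 (show D n s < ⌈s * (n + 1)⌉₊ by simp only [D]; omega)).le
      refine tendsto_of_tendsto_of_tendsto_of_le_of_le ?_ tendsto_const_nhds hlow hup
      have := tendsto_one_div_add_atTop_nhds_zero_nat (𝕜 := ℝ≥0)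
      simpa using tendsto_const_nhds (x := s) |>.sub this
    · have hpos : (0 : ℝ≥0) < n + 1 := by positivity
      simp only [mem_Iio]
      rw [div_lt_iff₀ hpos]
      have : 0 < ⌈s * (n + 1)⌉₊ := Nat.ceil_pos.2 (by positivity)
      exact Nat.lt_ceil.1 (show D n s < ⌈s * (n + 1)⌉₊ by simp only [D]; omega)

/-- A right-continuous process with measurable marginals is jointly measurable. -/
theorem measurable_uncurry_of_right_limits {u : ℝ≥0 → Ω → ℝ} (hu : ∀ t, Measurable (u t))
    (hr : ∀ s ω, Tendsto (fun r => u r ω) (𝓝[>] s) (𝓝 (u s ω))) :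
    Measurable (fun p : ℝ≥0 × Ω => u p.1 p.2) := by
  let w : ℕ → ℕ × Ω → ℝ := fun n q => u ((q.1 + 1 : ℝ≥0) / (n + 1)) q.2
  have hw : ∀ n, Measurable (w n) := fun n =>
    measurable_from_prod_countable_right fun j => hu ((j + 1 : ℝ≥0) / (n + 1))
  -- With the `+ 1` in `w`, this selects the first grid point strictly after the given time, as
  -- right limits require.
  let e : ℕ → ℝ≥0 × Ω → ℕ × Ω := fun n p => (⌊p.1 * (n + 1)⌋₊, p.2)
  have he : ∀ n, Measurable (e n) := fun n =>
    (Nat.measurable_floor.comp (measurable_fst.mul_const _)).prodMk measurable_snd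
  have hD : ∀ n, Measurable (w n ∘ e n) := fun n => (hw n).comp (he n)
  refine measurable_of_tendsto_metrizable hD ?_
  rw [tendsto_pi_nhds]
  rintro ⟨s, ω⟩
  refine (hr s ω).comp (tendsto_nhdsWithin_iff.2 ⟨?_, Eventually.of_forall fun n => ?_⟩)
  · have hup : ∀ n : ℕ, (⌊s * (n + 1)⌋₊ + 1 : ℝ≥0) / (n + 1) ≤ s + 1 / ((n : ℝ≥0) + 1) := by
      intro n
      have hpos : (0 : ℝ≥0) < n + 1 := by positivity
      rw [add_div]
      gcongr
      rw [div_le_iff₀ hpos]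
      exact Nat.floor_le (by positivity)
    have hlow : ∀ n : ℕ, s ≤ (⌊s * (n + 1)⌋₊ + 1 : ℝ≥0) / (n + 1) := by
      intro n
      have hpos : (0 : ℝ≥0) < n + 1 := by positivity
      rw [le_div_iff₀ hpos]
      exact (Nat.lt_floor_add_one _).le
    refine tendsto_of_tendsto_of_tendsto_of_le_of_le tendsto_const_nhds ?_ hlow hup
    have := tendsto_one_div_add_atTop_nhds_zero_nat (𝕜 := ℝ≥0)
    simpa using tendsto_const_nhds (x := s) |>.add this
  · have hpos : (0 : ℝ≥0) < n + 1 := by positivity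
    simp only [mem_Ioi]
    rw [lt_div_iff₀ hpos]
    exact Nat.lt_floor_add_one _

end Predictable

section Marked

variable {Ω : Type*} {mΩ : MeasurableSpace Ω} {P : Measure Ω}
  {𝓕 : Filtration ℝ≥0 mΩ} {d : ℕ} {μ : ℝ → (Fin d → ℝ) → (Fin d → ℝ)}
  {B : Matrix (Fin d) (Fin d) ℝ} {κ : Fin d → Kernel (Fin d → ℝ) ℝ} {x₀ : Fin d → ℝ}
  {T : ℕ → Ω → ℝ≥0∞} {X : ℕ → Ω → Fin d} {Y : ℕ → Fin d → Ω → ℝ} {L : ℝ≥0 → Ω → (Fin d → ℝ)}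

/-- The sum `∑ₙ 1{X_n = k, T_n < ∞} H(T_n) φ(Y_n^k)`. -/
noncomputable def markedSum {Ω : Type*} {d : ℕ} (T : ℕ → Ω → ℝ≥0∞) (X : ℕ → Ω → Fin d)
    (Y : ℕ → Fin d → Ω → ℝ) (k : Fin d) (H : ℝ≥0 × Ω → ℝ≥0∞) (φ : ℝ → ℝ≥0∞) (ω : Ω) : ℝ≥0∞ :=
  ∑' n, if X n ω = k ∧ T n ω ≠ ∞ then H ((T n ω).toNNReal, ω) * φ (Y n k ω) else 0

theorem measurable_markedSum (hL : IsSelfExcitingJumpProcess P 𝓕 μ B κ x₀ T X Y L) (k : Fin d)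
    {H : ℝ≥0 × Ω → ℝ≥0∞} (hH : Measurable H) {φ : ℝ → ℝ≥0∞} (hφ : Measurable φ) :
    Measurable (markedSum T X Y k H φ) := by
  refine Measurable.tsum fun n => Measurable.ite ?_ ?_ measurable_const
  · exact ((hL.measurable_type n) (measurableSet_singleton k)).inter
      ((hL.measurable_time n) (measurableSet_singleton ∞).compl)
  · exact (hH.comp ((hL.measurable_time n).ennreal_toNNReal.prodMk measurable_id)).mul
      (hφ.comp (hL.measurable_size n k))

/-- Event by event, the mark is independent of the predictable integrand at `T n`, so `φ` integrates
out to a constant; what is left is an unmarked sum, to which the defining property of the intensity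
applies. -/
theorem lintegral_markedSum [IsProbabilityMeasure P] {ν : Measure ℝ} [IsProbabilityMeasure ν]
    (hL : IsSelfExcitingJumpProcess P 𝓕 μ B κ x₀ T X Y L) (k : Fin d) (hk : ∀ x, κ k x = ν)
    {H : ℝ≥0 × Ω → ℝ≥0∞} (hH : Measurable[𝓕.predictable] H) {φ : ℝ → ℝ≥0∞} (hφ : Measurable φ) :
    ∫⁻ ω, markedSum T X Y k H φ ω ∂P = (∫⁻ y, φ y ∂ν) *
      ∫⁻ ω, (∫⁻ s in Ici (0 : ℝ), H (s.toNNReal, ω) * ENNReal.ofReal (L s.toNNReal ω k)) ∂P := by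
  have hH' : Measurable H := hH.mono (predictable_le_prod 𝓕) le_rfl
  have hE : ∀ n, MeasurableSet {ω | X n ω = k ∧ T n ω ≠ ∞} := fun n =>
    ((hL.measurable_type n) (measurableSet_singleton k)).inter
      ((hL.measurable_time n) (measurableSet_singleton ∞).compl)
  have hHT : ∀ n, Measurable fun ω => H ((T n ω).toNNReal, ω) := fun n =>
    hH'.comp ((hL.measurable_time n).ennreal_toNNReal.prodMk measurable_id)
  have hterm : ∀ n, ∫⁻ ω, (if X n ω = k ∧ T n ω ≠ ∞ then
        H ((T n ω).toNNReal, ω) * φ (Y n k ω) else 0) ∂P =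
      (∫⁻ y, φ y ∂ν) * ∫⁻ ω, (if X n ω = k ∧ T n ω ≠ ∞ then H ((T n ω).toNNReal, ω) else 0) ∂P := by
    intro n
    set E := {ω | X n ω = k ∧ T n ω ≠ ∞} with hEdef
    set h : Ω → ℝ≥0∞ := fun ω => if T n ω ≠ ∞ then H ((T n ω).toNNReal, ω) else 0 with hh
    have hhs : Measurable[strictPast 𝓕 (T n)] h := measurable_strictPast_of_predictable hH
    have hhm : Measurable h := hhs.mono (strictPast_le (hL.measurable_time n)) le_rfl
    have hYm := hL.measurable_size n k
    -- `size_law` on rectangles says that under `P` restricted to `E` the pair has a product law;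
    -- since the kernel is constant, the left limit in `size_law` plays no role.
    have hlaw : (P.restrict E).map (fun ω => (h ω, Y n k ω)) =
        ((P.restrict E).map h).prod ν := by
      symm
      refine Measure.prod_eq fun S C hS hC => ?_
      rw [Measure.map_apply (hhm.prodMk hYm) (hS.prod hC), Measure.map_apply hhm hS,
        Measure.restrict_apply ((hhm.prodMk hYm) (hS.prod hC)), Measure.restrict_apply (hhm hS)]
      have h1 := hL.size_law n k (h ⁻¹' S) C (hhs hS) hC
      simp only [hk, lintegral_const, Measure.restrict_apply MeasurableSet.univ, univ_inter] at h1
      rw [mul_comm, ← h1]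
      congr 1
      ext ω
      simp only [mem_inter_iff, mem_preimage, mem_prod, hEdef, mem_ofPred_eq]
      tauto
    have e1 : ∫⁻ ω, (if X n ω = k ∧ T n ω ≠ ∞ then
        H ((T n ω).toNNReal, ω) * φ (Y n k ω) else 0) ∂P =
        ∫⁻ ω in E, h ω * φ (Y n k ω) ∂P := by
      rw [← lintegral_indicator (hE n)]
      refine lintegral_congr fun ω => ?_
      by_cases hω : X n ω = k ∧ T n ω ≠ ∞
      · simp [hh, hω.1, hω.2]
      · rw [if_neg hω, indicator_of_notMem (show ω ∉ E from hω)]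
    have e2 : ∫⁻ ω, (if X n ω = k ∧ T n ω ≠ ∞ then H ((T n ω).toNNReal, ω) else 0) ∂P =
        ∫⁻ ω in E, h ω ∂P := by
      rw [← lintegral_indicator (hE n)]
      refine lintegral_congr fun ω => ?_
      by_cases hω : X n ω = k ∧ T n ω ≠ ∞
      · simp [hh, hω.1, hω.2]
      · rw [if_neg hω, indicator_of_notMem (show ω ∉ E from hω)]
    have e3 : ∫⁻ ω in E, h ω * φ (Y n k ω) ∂P =
        ∫⁻ p : ℝ≥0∞ × ℝ, p.1 * φ p.2 ∂((P.restrict E).map (fun ω => (h ω, Y n k ω))) := by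
      rw [lintegral_map _ (hhm.prodMk hYm)]
      exact measurable_fst.mul (hφ.comp measurable_snd)
    rw [e1, e2, e3, hlaw, lintegral_prod_mul (f := fun x => x) (g := φ) aemeasurable_id
      hφ.aemeasurable, lintegral_map (f := fun x => x) measurable_id hhm, mul_comm]
  have hsum : ∫⁻ ω, markedSum T X Y k H φ ω ∂P =
      (∫⁻ y, φ y ∂ν) * ∫⁻ ω, countingIntegral T X k H ω ∂P := by
    unfold markedSum countingIntegral
    rw [lintegral_tsum, lintegral_tsum, ← ENNReal.tsum_mul_left]
    · exact tsum_congr hterm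
    · exact fun n => (Measurable.ite (hE n) (hHT n) measurable_const).aemeasurable
    · exact fun n => (Measurable.ite (hE n) ((hHT n).mul (hφ.comp (hL.measurable_size n k)))
        measurable_const).aemeasurable
  rw [hsum, hL.intensity k H hH]

end Marked

/-! ### Paths of the intensity process -/

section JumpPath

variable {ι : Type*} {x : ℝ} {a : ℝ → ℝ} {I : Finset ι} {τ c : ι → ℝ} {s t : ℝ}

theorem continuousOn_primitive (ha : IntervalIntegrable a volume 0 t) (ht : 0 ≤ t) :
    ContinuousOn (fun s => ∫ r in (0 : ℝ)..s, a r) (Icc 0 t) := by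
  have := (ha.absolutelyContinuousOnInterval_intervalIntegral left_mem_uIcc).continuousOn
  rwa [uIcc_of_le ht] at this

theorem tendsto_jumpPath_left (ha : IntervalIntegrable a volume 0 t) (hs : s ∈ Icc 0 t) :
    Tendsto (jumpPath x a I τ c) (𝓝[Icc 0 t ∩ Iio s] s) (𝓝 (jumpPathLeft x a I τ c s)) := by
  have h1 : Tendsto (fun s => ∫ r in (0 : ℝ)..s, a r) (𝓝[Icc 0 t ∩ Iio s] s)
      (𝓝 (∫ r in (0 : ℝ)..s, a r)) :=
    (continuousOn_primitive ha (hs.1.trans hs.2) s hs).mono_left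
      (nhdsWithin_mono _ inter_subset_left)
  refine (h1.const_add x).add (tendsto_finsetSum _ fun n _ => tendsto_const_nhds.congr' ?_)
  by_cases h : τ n < s
  · have : ∀ᶠ r in 𝓝[Icc 0 t ∩ Iio s] s, τ n < r :=
      nhdsWithin_le_nhds (lt_mem_nhds h)
    filter_upwards [this] with r hr
    rw [if_pos h, if_pos hr.le]
  · filter_upwards [self_mem_nhdsWithin] with r hr
    rw [if_neg h, if_neg]
    exact fun h' => h (h'.trans_lt hr.2)

theorem tendsto_jumpPath_right (ha : IntervalIntegrable a volume 0 t) (hs : s ∈ Icc 0 t) :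
    Tendsto (jumpPath x a I τ c) (𝓝[Icc 0 t ∩ Ioi s] s) (𝓝 (jumpPath x a I τ c s)) := by
  have h1 : Tendsto (fun s => ∫ r in (0 : ℝ)..s, a r) (𝓝[Icc 0 t ∩ Ioi s] s)
      (𝓝 (∫ r in (0 : ℝ)..s, a r)) :=
    (continuousOn_primitive ha (hs.1.trans hs.2) s hs).mono_left
      (nhdsWithin_mono _ inter_subset_left)
  refine (h1.const_add x).add (tendsto_finsetSum _ fun n _ => tendsto_const_nhds.congr' ?_)
  by_cases h : τ n ≤ s
  · filter_upwards [self_mem_nhdsWithin] with r hr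
    rw [if_pos h, if_pos (h.trans (le_of_lt hr.2))]
  · have : ∀ᶠ r in 𝓝[Icc 0 t ∩ Ioi s] s, r < τ n :=
      nhdsWithin_le_nhds (gt_mem_nhds (not_le.1 h))
    filter_upwards [this] with r hr
    rw [if_neg h, if_neg (not_le.2 hr)]

theorem exists_bound_jumpPath (ha : IntervalIntegrable a volume 0 t) (ht : 0 ≤ t) :
    ∃ C, ∀ s ∈ Icc 0 t, |jumpPath x a I τ c s| ≤ C := by
  obtain ⟨C, hC⟩ := isCompact_Icc.exists_bound_of_continuousOn (continuousOn_primitive ha ht)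
  refine ⟨|x| + C + ∑ n ∈ I, |c n|, fun s hs => ?_⟩
  refine (abs_add_le _ _).trans (add_le_add ((abs_add_le _ _).trans ?_) ?_)
  · exact add_le_add le_rfl (hC s hs)
  · refine (Finset.abs_sum_le_sum_abs _ _).trans (Finset.sum_le_sum fun n _ => ?_)
    split_ifs <;> simp

end JumpPath

/-! ### Left limits, right continuity and the product formula for the intensity -/

section Path

variable {Ω : Type*} {mΩ : MeasurableSpace Ω} {P : Measure Ω}
  {𝓕 : Filtration ℝ≥0 mΩ} {d : ℕ} {μ : ℝ → (Fin d → ℝ) → (Fin d → ℝ)}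
  {B : Matrix (Fin d) (Fin d) ℝ} {κ : Fin d → Kernel (Fin d → ℝ) ℝ} {x₀ : Fin d → ℝ}
  {T : ℕ → Ω → ℝ≥0∞} {X : ℕ → Ω → Fin d} {Y : ℕ → Fin d → Ω → ℝ} {L : ℝ≥0 → Ω → (Fin d → ℝ)}

/-- The left-continuous version `L(t-)` of the intensity process. -/
noncomputable def leftIntensity {Ω : Type*} {d : ℕ} (μ : ℝ → (Fin d → ℝ) → (Fin d → ℝ))
    (B : Matrix (Fin d) (Fin d) ℝ) (x₀ : Fin d → ℝ) (T : ℕ → Ω → ℝ≥0∞) (X : ℕ → Ω → Fin d)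
    (Y : ℕ → Fin d → Ω → ℝ) (L : ℝ≥0 → Ω → (Fin d → ℝ)) (t : ℝ≥0) (ω : Ω) : Fin d → ℝ :=
  x₀ + (∫ s in (0 : ℝ)..t, μ s (L s.toNNReal ω)) +
    B *ᵥ fun k => ∑' n, if X n ω = k ∧ T n ω < (t : ℝ≥0∞) then Y n k ω else 0

namespace IsSelfExcitingJumpProcess

theorem toReal_le_iff {t s : ℝ≥0} {ω : Ω} {I : Finset ℕ} (hI : ∀ n, n ∈ I ↔ T n ω ≤ t)
    {n : ℕ} (hn : n ∈ I) : ((T n ω).toReal ≤ s ↔ T n ω ≤ s) ∧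
      ((T n ω).toReal < s ↔ T n ω < s) := by
  have hfin : T n ω ≠ ∞ := (((hI n).1 hn).trans_lt ENNReal.coe_lt_top).ne
  constructor
  · rw [← ENNReal.toReal_le_toReal hfin ENNReal.coe_ne_top, ENNReal.coe_toReal]
  · rw [← ENNReal.toReal_lt_toReal hfin ENNReal.coe_ne_top, ENNReal.coe_toReal]

/-- The predicate `p` is left abstract so that the same computation serves the path (`T n ≤ s`) and
its left limit (`T n < s`). -/
theorem mulVec_jumps {t : ℝ≥0} {ω : Ω} {I : Finset ℕ} (hI : ∀ n, n ∈ I ↔ T n ω ≤ t)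
    (p : ℕ → Prop) [DecidablePred p] (hp : ∀ n, p n → T n ω ≤ t) (i : Fin d) :
    (B *ᵥ fun k => ∑' n, if X n ω = k ∧ p n then Y n k ω else 0) i =
      ∑ n ∈ I, if p n then B i (X n ω) * Y n (X n ω) ω else 0 := by
  have h : ∀ k, (∑' n, if X n ω = k ∧ p n then Y n k ω else 0) =
      ∑ n ∈ I, if X n ω = k ∧ p n then Y n k ω else 0 := by
    intro k
    refine tsum_eq_sum fun n hn => if_neg fun h => hn ((hI n).2 (hp n h.2))
  simp only [Matrix.mulVec, dotProduct, h, Finset.mul_sum]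
  rw [Finset.sum_comm]
  refine Finset.sum_congr rfl fun n _ => ?_
  by_cases hpn : p n <;> simp [hpn]

variable (hL : IsSelfExcitingJumpProcess P 𝓕 μ B κ x₀ T X Y L)
include hL

theorem exists_events (t : ℝ≥0) (ω : Ω) : ∃ I : Finset ℕ, ∀ n, n ∈ I ↔ T n ω ≤ t := by
  have h := (hL.nonexplosive ω).eventually (lt_mem_nhds (ENNReal.coe_lt_top (r := t)))
  obtain ⟨N, hN⟩ := eventually_atTop.1 h
  refine ⟨(Finset.range N).filter fun n => T n ω ≤ t, fun n => ?_⟩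
  simp only [Finset.mem_filter, Finset.mem_range, and_iff_right_iff_imp]
  intro hn
  by_contra hlt
  exact absurd (hN n (not_lt.1 hlt)) (not_lt.2 hn)

/-- No two events coincide; this is the injectivity demanded by the product formula. -/
theorem injOn_time {t : ℝ≥0} {ω : Ω} {I : Finset ℕ} (hI : ∀ n, n ∈ I ↔ T n ω ≤ t) :
    InjOn (fun n => (T n ω).toReal) (I : Set ℕ) := by
  have hfin : ∀ n ∈ I, T n ω ≠ ∞ := fun n hn =>
    (((hI n).1 hn).trans_lt ENNReal.coe_lt_top).ne
  have hlt : ∀ m n, m < n → n ∈ I → T m ω < T n ω := by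
    intro m n hmn hn
    have hm : T m ω ≠ ∞ := ((hL.time_mono ω hmn.le).trans_lt (hfin n hn).lt_top).ne
    exact (hL.time_strict m ω hm).trans_le (hL.time_mono ω hmn)
  intro m hm n hn h
  have h' : T m ω = T n ω := (ENNReal.toReal_eq_toReal_iff' (hfin m hm) (hfin n hn)).1 h
  rcases lt_trichotomy m n with hmn | hmn | hmn
  · exact absurd h' (hlt m n hmn hn).ne
  · exact hmn
  · exact absurd h'.symm (hlt n m hmn hm).ne

theorem intervalIntegrable_drift (t : ℝ≥0) (ω : Ω) (i : Fin d) :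
    IntervalIntegrable (fun s : ℝ => μ s (L s.toNNReal ω) i) volume 0 t :=
  ⟨(hL.drift_integrable t ω).1.eval i, (hL.drift_integrable t ω).2.eval i⟩

theorem integral_drift_apply (t : ℝ≥0) (ω : Ω) (i : Fin d) :
    (∫ s in (0 : ℝ)..t, μ s (L s.toNNReal ω)) i =
      ∫ s in (0 : ℝ)..t, μ s (L s.toNNReal ω) i :=
  ((ContinuousLinearMap.proj (R := ℝ) (φ := fun _ : Fin d => ℝ) i).intervalIntegral_comp_comm
    (hL.drift_integrable t ω)).symm

theorem eq_jumpPath {t s : ℝ≥0} {ω : Ω} {I : Finset ℕ} (hI : ∀ n, n ∈ I ↔ T n ω ≤ t)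
    (hs : s ≤ t) (i : Fin d) :
    L s ω i = jumpPath (x₀ i) (fun r => μ r (L r.toNNReal ω) i) I (fun n => (T n ω).toReal)
      (fun n => B i (X n ω) * Y n (X n ω) ω) s := by
  rw [hL.sde s ω, Pi.add_apply, Pi.add_apply, hL.integral_drift_apply]
  unfold jumpProcess
  rw [mulVec_jumps hI (fun n => T n ω ≤ s) (fun n hn => hn.trans (by exact_mod_cast hs))]
  unfold jumpPath
  congr 1
  exact Finset.sum_congr rfl fun n hn => by simp only [(toReal_le_iff hI hn).1]

theorem leftIntensity_eq_jumpPathLeft {t s : ℝ≥0} {ω : Ω} {I : Finset ℕ}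
    (hI : ∀ n, n ∈ I ↔ T n ω ≤ t) (hs : s ≤ t) (i : Fin d) :
    leftIntensity μ B x₀ T X Y L s ω i =
      jumpPathLeft (x₀ i) (fun r => μ r (L r.toNNReal ω) i) I (fun n => (T n ω).toReal)
        (fun n => B i (X n ω) * Y n (X n ω) ω) s := by
  unfold leftIntensity
  rw [Pi.add_apply, Pi.add_apply, hL.integral_drift_apply,
    mulVec_jumps hI (fun n => T n ω < s) (fun n hn => hn.le.trans (by exact_mod_cast hs))]
  unfold jumpPathLeft
  congr 1
  exact Finset.sum_congr rfl fun n hn => by simp only [(toReal_le_iff hI hn).2]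

theorem tendsto_left (s : ℝ≥0) (ω : Ω) (i : Fin d) :
    Tendsto (fun r => L r ω i) (𝓝[<] s) (𝓝 (leftIntensity μ B x₀ T X Y L s ω i)) := by
  obtain ⟨I, hI⟩ := hL.exists_events s ω
  rw [hL.leftIntensity_eq_jumpPathLeft hI le_rfl]
  have hc : Tendsto (fun r : ℝ≥0 => (r : ℝ)) (𝓝[<] s) (𝓝[Icc 0 (s : ℝ) ∩ Iio (s : ℝ)] s) := by
    refine tendsto_nhdsWithin_iff.2
      ⟨NNReal.continuous_coe.continuousAt.mono_left nhdsWithin_le_nhds, ?_⟩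
    filter_upwards [self_mem_nhdsWithin] with r hr
    have : (r : ℝ) < s := hr
    exact ⟨⟨r.2, this.le⟩, this⟩
  refine ((tendsto_jumpPath_left (hL.intervalIntegrable_drift s ω i)
    ⟨s.2, le_rfl⟩).comp hc).congr' ?_
  filter_upwards [self_mem_nhdsWithin] with r hr
  exact (hL.eq_jumpPath hI (le_of_lt hr) i).symm

theorem tendsto_right (s : ℝ≥0) (ω : Ω) (i : Fin d) :
    Tendsto (fun r => L r ω i) (𝓝[>] s) (𝓝 (L s ω i)) := by
  -- The path must be described on a right neighbourhood of `s`, hence events up to `s + 1`.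
  obtain ⟨I, hI⟩ := hL.exists_events (s + 1) ω
  rw [hL.eq_jumpPath hI (le_add_of_nonneg_right zero_le_one)]
  have hlt : ∀ᶠ r in 𝓝[>] s, r < s + 1 :=
    nhdsWithin_le_nhds (gt_mem_nhds (lt_add_of_pos_right s one_pos))
  have hc : Tendsto (fun r : ℝ≥0 => (r : ℝ)) (𝓝[>] s)
      (𝓝[Icc 0 ((s + 1 : ℝ≥0) : ℝ) ∩ Ioi (s : ℝ)] s) := by
    refine tendsto_nhdsWithin_iff.2
      ⟨NNReal.continuous_coe.continuousAt.mono_left nhdsWithin_le_nhds, ?_⟩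
    filter_upwards [self_mem_nhdsWithin, hlt] with r hr hr'
    exact ⟨⟨r.2, by exact_mod_cast hr'.le⟩, by exact_mod_cast hr⟩
  refine ((tendsto_jumpPath_right (hL.intervalIntegrable_drift (s + 1) ω i)
    ⟨s.2, by simp⟩).comp hc).congr' ?_
  filter_upwards [hlt] with r hr
  exact (hL.eq_jumpPath hI hr.le i).symm

theorem exists_path_bound (t : ℝ≥0) (ω : Ω) : ∃ C, ∀ s ≤ t, ∀ i, |L s ω i| ≤ C := by
  obtain ⟨I, hI⟩ := hL.exists_events t ω
  have h : ∀ i, ∃ C, ∀ s ≤ t, |L s ω i| ≤ C := by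
    intro i
    obtain ⟨C, hC⟩ := exists_bound_jumpPath (x := x₀ i) (I := I) (τ := fun n => (T n ω).toReal)
      (c := fun n => B i (X n ω) * Y n (X n ω) ω) (hL.intervalIntegrable_drift t ω i) t.2
    refine ⟨C, fun s hs => ?_⟩
    rw [hL.eq_jumpPath hI hs]
    exact hC s ⟨s.2, by exact_mod_cast hs⟩
  choose C hC using h
  refine ⟨∑ i, |C i|, fun s hs i => (hC i s hs).trans ((le_abs_self _).trans ?_)⟩
  exact Finset.single_le_sum (f := fun i => |C i|) (fun i _ => abs_nonneg _) (Finset.mem_univ i)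

theorem leftIntensity_zero (ω : Ω) : leftIntensity μ B x₀ T X Y L 0 ω = L 0 ω := by
  rw [hL.sde 0 ω]
  unfold leftIntensity jumpProcess
  have h : ∀ n, ¬ T n ω ≤ 0 := fun n hn =>
    absurd ((hL.time_pos ω).trans_le (hL.time_mono ω (Nat.zero_le n))) (not_lt.2 hn)
  simp [h]

/-- The path and its left limit differ only at event times, which are countable. This is why left
limits may be replaced by values under `ds`. -/
theorem leftIntensity_ae_eq (ω : Ω) :
    ∀ᵐ s : ℝ, leftIntensity μ B x₀ T X Y L s.toNNReal ω = L s.toNNReal ω := by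
  have hc : (range fun n => (T n ω).toReal).Countable := countable_range _
  filter_upwards [hc.ae_notMem volume] with s hs
  rcases le_or_gt s 0 with h0 | h0
  · rw [Real.toNNReal_of_nonpos h0, hL.leftIntensity_zero]
  · rw [hL.sde]
    unfold leftIntensity jumpProcess
    have h : ∀ n, T n ω < s.toNNReal ↔ T n ω ≤ s.toNNReal := by
      intro n
      refine ⟨le_of_lt, fun h => lt_of_le_of_ne h fun he => hs ⟨n, ?_⟩⟩
      simp [he, h0.le]
    simp only [h]

theorem measurable_leftIntensity (i : Fin d) : Measurable[𝓕.predictable]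
    (fun p : ℝ≥0 × Ω => leftIntensity μ B x₀ T X Y L p.1 p.2 i) := by
  refine measurable_predictable_of_left_limits (u := fun t ω => L t ω i)
    (v := fun t ω => leftIntensity μ B x₀ T X Y L t ω i)
    (fun t => (measurable_pi_apply i).comp (hL.intensity_adapted t)) ?_
    fun s ω _ => hL.tendsto_left s ω i
  funext ω
  rw [hL.leftIntensity_zero]

theorem measurable_intensity_apply (t : ℝ≥0) (i : Fin d) : Measurable fun ω => L t ω i :=
  ((measurable_pi_apply i).comp (hL.intensity_adapted t)).mono (𝓕.le t) le_rfl

theorem measurable_intensity_uncurry (i : Fin d) :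
    Measurable (fun p : ℝ≥0 × Ω => L p.1 p.2 i) :=
  measurable_uncurry_of_right_limits (fun t => hL.measurable_intensity_apply t i)
    fun s ω => hL.tendsto_right s ω i

theorem measurable_intensity_real (i : Fin d) :
    Measurable (fun p : Ω × ℝ => L p.2.toNNReal p.1 i) :=
  (hL.measurable_intensity_uncurry i).comp (measurable_snd.real_toNNReal.prodMk measurable_fst)

/-- `jumpPath_mul_jumpPath` applied to two coordinates, which jump at the same events: an event of
type `k` moves coordinate `i` by `B i k` times its size. -/
theorem mul_eq {t : ℝ≥0} {ω : Ω} {I : Finset ℕ} (hI : ∀ n, n ∈ I ↔ T n ω ≤ t) (i j : Fin d) :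
    L t ω i * L t ω j = x₀ i * x₀ j +
      (∫ s in (0 : ℝ)..t, (μ s (L s.toNNReal ω) i * L s.toNNReal ω j +
        L s.toNNReal ω i * μ s (L s.toNNReal ω) j)) +
      ∑ n ∈ I, (leftIntensity μ B x₀ T X Y L (T n ω).toNNReal ω i *
          (B j (X n ω) * Y n (X n ω) ω) +
        leftIntensity μ B x₀ T X Y L (T n ω).toNNReal ω j * (B i (X n ω) * Y n (X n ω) ω) +
        (B i (X n ω) * Y n (X n ω) ω) * (B j (X n ω) * Y n (X n ω) ω)) := by
  have hfin : ∀ n ∈ I, T n ω ≠ ∞ := fun n hn =>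
    (((hI n).1 hn).trans_lt ENNReal.coe_lt_top).ne
  have hle : ∀ n ∈ I, (T n ω).toNNReal ≤ t := fun n hn =>
    (ENNReal.toNNReal_mono ENNReal.coe_ne_top ((hI n).1 hn)).trans_eq (ENNReal.toNNReal_coe t)
  rw [hL.eq_jumpPath hI le_rfl i, hL.eq_jumpPath hI le_rfl j,
    jumpPath_mul_jumpPath _ _ t.coe_nonneg (hL.intervalIntegrable_drift t ω i)
      (hL.intervalIntegrable_drift t ω j) I (fun n => (T n ω).toReal)
      (fun n => B i (X n ω) * Y n (X n ω) ω) (fun n => B j (X n ω) * Y n (X n ω) ω)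
      (fun n hn => ⟨ENNReal.toReal_nonneg, hle n hn⟩) (hL.injOn_time hI)]
  congr 1
  · congr 1
    refine intervalIntegral.integral_congr fun s hs => ?_
    rw [uIcc_of_le t.coe_nonneg] at hs
    have hst : s.toNNReal ≤ t := Real.toNNReal_le_iff_le_coe.2 hs.2
    have hss : (s.toNNReal : ℝ) = s := Real.coe_toNNReal s hs.1
    have h1 := hL.eq_jumpPath hI hst i
    have h2 := hL.eq_jumpPath hI hst j
    rw [hss] at h1 h2
    simp only [← h1, ← h2]
  · refine Finset.sum_congr rfl fun n hn => ?_
    rw [hL.leftIntensity_eq_jumpPathLeft hI (hle n hn) i,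
      hL.leftIntensity_eq_jumpPathLeft hI (hle n hn) j]
    rfl

theorem apply_eq {t : ℝ≥0} {ω : Ω} {I : Finset ℕ} (hI : ∀ n, n ∈ I ↔ T n ω ≤ t) (i : Fin d) :
    L t ω i = x₀ i + (∫ s in (0 : ℝ)..t, μ s (L s.toNNReal ω) i) +
      ∑ n ∈ I, B i (X n ω) * Y n (X n ω) ω := by
  rw [hL.eq_jumpPath hI le_rfl i]
  unfold jumpPath
  congr 1
  exact Finset.sum_congr rfl fun n hn => if_pos ((toReal_le_iff hI hn).1.2 ((hI n).1 hn))

end IsSelfExcitingJumpProcess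

end Path

/-! ### Compensation on a bounded time interval, for non-negative and for real integrands -/

section MarkedIntegral

variable {Ω : Type*} {mΩ : MeasurableSpace Ω} {P : Measure Ω}
  {𝓕 : Filtration ℝ≥0 mΩ} {d : ℕ} {μ : ℝ → (Fin d → ℝ) → (Fin d → ℝ)}
  {B : Matrix (Fin d) (Fin d) ℝ} {κ : Fin d → Kernel (Fin d → ℝ) ℝ} {x₀ : Fin d → ℝ}
  {T : ℕ → Ω → ℝ≥0∞} {X : ℕ → Ω → Fin d} {Y : ℕ → Fin d → Ω → ℝ} {L : ℝ≥0 → Ω → (Fin d → ℝ)}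

theorem measurable_indicator_Iic {𝓕 : Filtration ℝ≥0 mΩ} {H : ℝ≥0 × Ω → ℝ≥0∞}
    (hH : Measurable[𝓕.predictable] H) (t : ℝ≥0) :
    Measurable[𝓕.predictable] ((Iic t ×ˢ univ).indicator H) := by
  have h : MeasurableSet[𝓕.predictable] (Iic t ×ˢ (univ : Set Ω)) := by
    have : Iic t ×ˢ (univ : Set Ω) = (Ioi t ×ˢ univ)ᶜ := by
      ext ⟨s, ω⟩; simp
    rw [this]
    exact @MeasurableSet.compl _ _ 𝓕.predictable
      (measurableSet_predictable_Ioi_prod (@MeasurableSet.univ Ω (𝓕 t)))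
  exact Measurable.indicator (mβ := inferInstance) hH h

theorem markedSum_indicator_Iic {t : ℝ≥0} {ω : Ω} {I : Finset ℕ} (hI : ∀ n, n ∈ I ↔ T n ω ≤ t)
    (k : Fin d) (H : ℝ≥0 × Ω → ℝ≥0∞) (φ : ℝ → ℝ≥0∞) :
    markedSum T X Y k ((Iic t ×ˢ univ).indicator H) φ ω =
      ∑ n ∈ I, if X n ω = k then H ((T n ω).toNNReal, ω) * φ (Y n k ω) else 0 := by
  have hiff : ∀ n, n ∈ I ↔ T n ω ≠ ∞ ∧ (T n ω).toNNReal ≤ t := by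
    intro n
    rw [hI]
    constructor
    · intro h
      exact ⟨(h.trans_lt ENNReal.coe_lt_top).ne,
        (ENNReal.toNNReal_mono ENNReal.coe_ne_top h).trans_eq (ENNReal.toNNReal_coe t)⟩
    · rintro ⟨h1, h2⟩
      rw [← ENNReal.coe_toNNReal h1]
      exact_mod_cast h2
  unfold markedSum
  rw [tsum_eq_sum (s := I)]
  · refine Finset.sum_congr rfl fun n hn => ?_
    have h := (hiff n).1 hn
    simp [h.1, h.2]
  · intro n hn
    by_cases hT : T n ω = ∞
    · simp [hT]
    · have h : ¬ (T n ω).toNNReal ≤ t := fun h => hn ((hiff n).2 ⟨hT, h⟩)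
      simp [h]

namespace IsSelfExcitingJumpProcess

variable (hL : IsSelfExcitingJumpProcess P 𝓕 μ B κ x₀ T X Y L)
include hL

theorem lintegral_markedSum_Iic [IsProbabilityMeasure P] {ν : Measure ℝ} [IsProbabilityMeasure ν]
    (k : Fin d) (hk : ∀ x, κ k x = ν) {H : ℝ≥0 × Ω → ℝ≥0∞} (hH : Measurable[𝓕.predictable] H)
    {φ : ℝ → ℝ≥0∞} (hφ : Measurable φ) (t : ℝ≥0) :
    ∫⁻ ω, markedSum T X Y k ((Iic t ×ˢ univ).indicator H) φ ω ∂P = (∫⁻ y, φ y ∂ν) *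
      ∫⁻ p : Ω × ℝ, H (p.2.toNNReal, p.1) * ENNReal.ofReal (L p.2.toNNReal p.1 k)
        ∂(P.prod (volume.restrict (Ioc 0 (t : ℝ)))) := by
  have hH' : Measurable H := hH.mono (predictable_le_prod 𝓕) le_rfl
  have hm : Measurable fun p : Ω × ℝ =>
      H (p.2.toNNReal, p.1) * ENNReal.ofReal (L p.2.toNNReal p.1 k) :=
    (hH'.comp (measurable_snd.real_toNNReal.prodMk measurable_fst)).mul
      (hL.measurable_intensity_real k).ennreal_ofReal
  rw [lintegral_markedSum hL k hk (measurable_indicator_Iic hH t) hφ,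
    lintegral_prod _ hm.aemeasurable]
  congr 1
  refine lintegral_congr fun ω => ?_
  have h1 : ∀ s ∈ Ici (0 : ℝ), (Iic t ×ˢ univ).indicator H (s.toNNReal, ω) *
      ENNReal.ofReal (L s.toNNReal ω k) = (Iic (t : ℝ)).indicator
        (fun s : ℝ => H (s.toNNReal, ω) * ENNReal.ofReal (L s.toNNReal ω k)) s := by
    intro s hs
    have : s.toNNReal ≤ t ↔ s ≤ t := Real.toNNReal_le_iff_le_coe
    by_cases h : s ≤ t <;> simp [h, this]
  rw [setLIntegral_congr_fun measurableSet_Ici h1, setLIntegral_indicator measurableSet_Iic,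
    inter_comm, Ici_inter_Iic]
  exact setLIntegral_congr Ioc_ae_eq_Icc.symm

/-- The law `ν` is not assumed to live on `[0, ∞)`, whereas jump sizes are non-negative.
Compensating with `φ = 1_{y < 0}` makes the event sum vanish, so if `ν` charges the negatives,
component `k` has no intensity mass. -/
theorem lintegral_eq_zero_of_charges_neg [IsProbabilityMeasure P] {ν : Measure ℝ}
    [IsProbabilityMeasure ν] (k : Fin d) (hk : ∀ x, κ k x = ν) (hν : ν (Iio 0) ≠ 0)
    {H : ℝ≥0 × Ω → ℝ≥0∞} (hH : Measurable[𝓕.predictable] H) (t : ℝ≥0) :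
    ∫⁻ p : Ω × ℝ, H (p.2.toNNReal, p.1) * ENNReal.ofReal (L p.2.toNNReal p.1 k)
        ∂(P.prod (volume.restrict (Ioc 0 (t : ℝ)))) = 0 := by
  have h := hL.lintegral_markedSum_Iic k hk hH
    (φ := (Iio 0).indicator 1) (measurable_one.indicator measurableSet_Iio) t
  have h0 : ∀ H : ℝ≥0 × Ω → ℝ≥0∞, ∀ ω, markedSum T X Y k H ((Iio 0).indicator 1) ω = 0 := by
    intro H ω
    unfold markedSum
    simp [hL.size_nonneg]
  simp only [h0, lintegral_zero, lintegral_indicator_one measurableSet_Iio] at h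
  exact (mul_eq_zero.1 h.symm).resolve_left hν

/-- The compensation formula for real-valued predictable integrands. -/
theorem integral_markedSum [IsProbabilityMeasure P] {ν : Measure ℝ} [IsProbabilityMeasure ν]
    (k : Fin d) (hk : ∀ x, κ k x = ν) {H : ℝ≥0 × Ω → ℝ} (hH : Measurable[𝓕.predictable] H)
    {φ : ℝ → ℝ} (hφ : Measurable φ) (hφ0 : ∀ y, 0 ≤ y → 0 ≤ φ y) (hφi : Integrable φ ν) (t : ℝ≥0)
    (hint : Integrable (fun p : Ω × ℝ => H (p.2.toNNReal, p.1) * L p.2.toNNReal p.1 k)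
      (P.prod (volume.restrict (Ioc 0 (t : ℝ)))))
    {G : Ω → ℝ} (hG : ∀ ω (I : Finset ℕ), (∀ n, n ∈ I ↔ T n ω ≤ t) →
      G ω = ∑ n ∈ I, if X n ω = k then H ((T n ω).toNNReal, ω) * φ (Y n k ω) else 0) :
    Integrable G P ∧ ∫ ω, G ω ∂P = (∫ y, φ y ∂ν) *
      ∫ p : Ω × ℝ, H (p.2.toNNReal, p.1) * L p.2.toNNReal p.1 k
        ∂(P.prod (volume.restrict (Ioc 0 (t : ℝ)))) := by
  set ρ := P.prod (volume.restrict (Ioc 0 (t : ℝ))) with hρ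
  set f : Ω × ℝ → ℝ := fun p => H (p.2.toNNReal, p.1) * L p.2.toNNReal p.1 k with hf
  have hpos : Measurable[𝓕.predictable] fun q => ENNReal.ofReal (H q) :=
    ENNReal.measurable_ofReal.comp hH
  have hneg : Measurable[𝓕.predictable] fun q => ENNReal.ofReal (-H q) :=
    ENNReal.measurable_ofReal.comp (measurable_neg.comp hH)
  set Gp : Ω → ℝ≥0∞ := markedSum T X Y k
    ((Iic t ×ˢ univ).indicator fun q => ENNReal.ofReal (H q)) fun y => ENNReal.ofReal (φ y) with hGp
  set Gn : Ω → ℝ≥0∞ := markedSum T X Y k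
    ((Iic t ×ˢ univ).indicator fun q => ENNReal.ofReal (-H q)) fun y => ENNReal.ofReal (φ y)
    with hGn
  have hmp : Measurable Gp := measurable_markedSum hL k
    ((measurable_indicator_Iic hpos t).mono (predictable_le_prod 𝓕) le_rfl) hφ.ennreal_ofReal
  have hmn : Measurable Gn := measurable_markedSum hL k
    ((measurable_indicator_Iic hneg t).mono (predictable_le_prod 𝓕) le_rfl) hφ.ennreal_ofReal
  set m := ∫⁻ y, ENNReal.ofReal (φ y) ∂ν with hm
  have hmfin : m ≠ ∞ := by
    refine ((lintegral_mono fun y => ?_).trans_lt hφi.2).ne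
    rw [Real.enorm_eq_ofReal_abs]
    exact ENNReal.ofReal_le_ofReal (le_abs_self _)
  have hIp : ∫⁻ ω, Gp ω ∂P = m * ∫⁻ p, ENNReal.ofReal (f p) ∂ρ := by
    rw [hGp, hL.lintegral_markedSum_Iic k hk hpos hφ.ennreal_ofReal t]
    congr 1
    refine lintegral_congr fun p => ?_
    rw [hf, ← ENNReal.ofReal_mul' (hL.intensity_nonneg _ _ _)]
  have hIn : ∫⁻ ω, Gn ω ∂P = m * ∫⁻ p, ENNReal.ofReal (-f p) ∂ρ := by
    rw [hGn, hL.lintegral_markedSum_Iic k hk hneg hφ.ennreal_ofReal t]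
    congr 1
    refine lintegral_congr fun p => ?_
    rw [hf, ← ENNReal.ofReal_mul' (hL.intensity_nonneg _ _ _), neg_mul]
  have hfp : ∫⁻ p, ENNReal.ofReal (f p) ∂ρ ≠ ∞ := by
    refine ((lintegral_mono fun y => ?_).trans_lt hint.2).ne
    rw [Real.enorm_eq_ofReal_abs]
    exact ENNReal.ofReal_le_ofReal (le_abs_self _)
  have hfn : ∫⁻ p, ENNReal.ofReal (-f p) ∂ρ ≠ ∞ := by
    refine ((lintegral_mono fun y => ?_).trans_lt hint.2).ne
    rw [Real.enorm_eq_ofReal_abs]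
    exact ENNReal.ofReal_le_ofReal (neg_le_abs _)
  have hIp' : ∫⁻ ω, Gp ω ∂P ≠ ∞ := hIp ▸ ENNReal.mul_ne_top hmfin hfp
  have hIn' : ∫⁻ ω, Gn ω ∂P ≠ ∞ := hIn ▸ ENNReal.mul_ne_top hmfin hfn
  -- Only `H` is split into positive and negative parts; `φ` is non-negative at every actual jump
  -- size.
  have hGeq : G = fun ω => (Gp ω).toReal - (Gn ω).toReal := by
    funext ω
    obtain ⟨I, hI⟩ := hL.exists_events t ω
    rw [hG ω I hI, hGp, hGn, markedSum_indicator_Iic hI, markedSum_indicator_Iic hI,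
      ENNReal.toReal_sum, ENNReal.toReal_sum, ← Finset.sum_sub_distrib]
    · refine Finset.sum_congr rfl fun n _ => ?_
      split_ifs with hX
      · have h0 := hφ0 _ (hL.size_nonneg n k ω)
        rw [ENNReal.toReal_mul, ENNReal.toReal_mul, ENNReal.toReal_ofReal h0, ← sub_mul]
        congr 1
        rcases le_total 0 (H ((T n ω).toNNReal, ω)) with h | h
        · rw [ENNReal.toReal_ofReal h, ENNReal.ofReal_of_nonpos (neg_nonpos.2 h)]; simp
        · rw [ENNReal.toReal_ofReal (neg_nonneg.2 h), ENNReal.ofReal_of_nonpos h]; simp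
      · simp
    · intro n _
      split_ifs
      · exact ENNReal.mul_ne_top ENNReal.ofReal_ne_top ENNReal.ofReal_ne_top
      · simp
    · intro n _
      split_ifs
      · exact ENNReal.mul_ne_top ENNReal.ofReal_ne_top ENNReal.ofReal_ne_top
      · simp
  have hip := integrable_toReal_of_lintegral_ne_top hmp.aemeasurable hIp'
  have hin := integrable_toReal_of_lintegral_ne_top hmn.aemeasurable hIn'
  have hval : ∫ ω, G ω ∂P = m.toReal * ∫ p, f p ∂ρ := by
    rw [hGeq, integral_sub hip hin,
      integral_toReal hmp.aemeasurable (ae_lt_top hmp hIp'),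
      integral_toReal hmn.aemeasurable (ae_lt_top hmn hIn'), hIp, hIn, ENNReal.toReal_mul,
      ENNReal.toReal_mul, integral_eq_lintegral_pos_part_sub_lintegral_neg_part hint]
    ring
  refine ⟨hGeq ▸ hip.sub hin, ?_⟩
  rw [hval]
  -- So far the constant is the integral of the positive part of `φ`. It equals `∫ φ dν` when `ν`
  -- lives on `[0, ∞)`; otherwise the intensity integral is zero and the constant is irrelevant.
  by_cases hν : ν (Iio 0) = 0
  · have hae : 0 ≤ᵐ[ν] φ := by
      have : ∀ᵐ y ∂ν, y ∉ Iio (0 : ℝ) := measure_eq_zero_iff_ae_notMem.1 hν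
      filter_upwards [this] with y hy using hφ0 y (not_lt.1 hy)
    rw [integral_eq_lintegral_of_nonneg_ae hae hφ.aestronglyMeasurable]
  · have h1 := hL.lintegral_eq_zero_of_charges_neg k hk hν hpos t
    have h2 := hL.lintegral_eq_zero_of_charges_neg k hk hν hneg t
    have hz : ∫ p, f p ∂ρ = 0 := by
      rw [integral_eq_lintegral_pos_part_sub_lintegral_neg_part hint]
      have e1 : ∫⁻ p, ENNReal.ofReal (f p) ∂ρ = 0 := by
        rw [← h1]
        refine lintegral_congr fun p => ?_
        rw [hf, ← ENNReal.ofReal_mul' (hL.intensity_nonneg _ _ _)]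
      have e2 : ∫⁻ p, ENNReal.ofReal (-f p) ∂ρ = 0 := by
        rw [← h2]
        refine lintegral_congr fun p => ?_
        rw [hf, ← ENNReal.ofReal_mul' (hL.intensity_nonneg _ _ _), neg_mul]
      rw [e1, e2]; simp
    rw [hz, mul_zero, mul_zero]

end IsSelfExcitingJumpProcess

end MarkedIntegral

/-! ### Local boundedness of the second moments -/

/-- The weight `1 + ∑ v_i²`. -/
noncomputable def momentWeight {d : ℕ} (v : Fin d → ℝ) : ℝ := 1 + ∑ i, v i ^ 2

section Weight

variable {d : ℕ} (v : Fin d → ℝ)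

theorem one_le_momentWeight : 1 ≤ momentWeight v :=
  le_add_of_nonneg_right (Finset.sum_nonneg fun i _ => sq_nonneg (v i))

theorem sq_le_momentWeight (i : Fin d) : 1 + v i ^ 2 ≤ momentWeight v :=
  add_le_add le_rfl (Finset.single_le_sum (f := fun i => v i ^ 2) (fun i _ => sq_nonneg (v i))
    (Finset.mem_univ i))

theorem abs_le_momentWeight (i : Fin d) : |v i| ≤ momentWeight v := by
  nlinarith [sq_le_momentWeight v i, sq_abs (v i), sq_nonneg (|v i| - 1), sq_nonneg (v i)]

theorem abs_mul_le_momentWeight (i j : Fin d) : |v i| * |v j| ≤ momentWeight v := by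
  nlinarith [sq_le_momentWeight v i, sq_le_momentWeight v j, sq_abs (v i), sq_abs (v j),
    sq_nonneg (|v i| - |v j|)]

theorem continuous_momentWeight : Continuous (momentWeight (d := d)) := by
  unfold momentWeight; fun_prop

/-- A bound for the drift `A (v - l₀)` relative to `momentWeight`. -/
noncomputable def driftBound (A : Matrix (Fin d) (Fin d) ℝ) (l₀ : Fin d → ℝ) : ℝ :=
  ∑ i, ∑ m, |A i m| * (1 + |l₀ m|)

theorem driftBound_nonneg (A : Matrix (Fin d) (Fin d) ℝ) (l₀ : Fin d → ℝ) :
    0 ≤ driftBound A l₀ :=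
  Finset.sum_nonneg fun _ _ => Finset.sum_nonneg fun _ _ => by positivity

/-- The factor `w` is `1` in the equation for the mean and a coordinate of `v` in the equation for
second moments. -/
theorem abs_drift_le (A : Matrix (Fin d) (Fin d) ℝ) (l₀ : Fin d → ℝ) {w : ℝ}
    (h1 : |w| ≤ momentWeight v) (h2 : ∀ m, |v m| * |w| ≤ momentWeight v) (i : Fin d) :
    |(A *ᵥ (v - l₀)) i * w| ≤ driftBound A l₀ * momentWeight v := by
  have hle : ∑ m, |A i m| * (1 + |l₀ m|) ≤ driftBound A l₀ :=
    Finset.single_le_sum (f := fun i => ∑ m, |A i m| * (1 + |l₀ m|))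
      (fun i _ => Finset.sum_nonneg fun _ _ => by positivity) (Finset.mem_univ i)
  refine le_trans ?_ (mul_le_mul_of_nonneg_right hle (zero_le_one.trans (one_le_momentWeight v)))
  rw [Finset.sum_mul, Matrix.mulVec, dotProduct, Finset.sum_mul]
  refine (Finset.abs_sum_le_sum_abs _ _).trans (Finset.sum_le_sum fun m _ => ?_)
  rw [abs_mul, abs_mul, mul_assoc, mul_assoc]
  refine mul_le_mul_of_nonneg_left ?_ (abs_nonneg _)
  calc |(v - l₀) m| * |w| ≤ (|v m| + |l₀ m|) * |w| :=
        mul_le_mul_of_nonneg_right (abs_sub _ _) (abs_nonneg _)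
    _ = |v m| * |w| + |l₀ m| * |w| := by ring
    _ ≤ momentWeight v + |l₀ m| * momentWeight v :=
        add_le_add (h2 m) (mul_le_mul_of_nonneg_left h1 (abs_nonneg _))
    _ = _ := by ring

theorem abs_drift_mul_le (A : Matrix (Fin d) (Fin d) ℝ) (l₀ : Fin d → ℝ) (i j : Fin d) :
    |(A *ᵥ (v - l₀)) i * v j| ≤ driftBound A l₀ * momentWeight v :=
  abs_drift_le v A l₀ (abs_le_momentWeight v j) (fun m => abs_mul_le_momentWeight v m j) i

end Weight

/-! ### Predictable localization of the weight -/

section Truncation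

variable {Ω : Type*} {mΩ : MeasurableSpace Ω} {P : Measure Ω}
  {𝓕 : Filtration ℝ≥0 mΩ} {d : ℕ} {μ : ℝ → (Fin d → ℝ) → (Fin d → ℝ)}
  {A B : Matrix (Fin d) (Fin d) ℝ} {κ : Fin d → Kernel (Fin d → ℝ) ℝ} {l₀ x₀ : Fin d → ℝ}
  {T : ℕ → Ω → ℝ≥0∞} {X : ℕ → Ω → Fin d} {Y : ℕ → Fin d → Ω → ℝ} {L : ℝ≥0 → Ω → (Fin d → ℝ)}

/-- The set of `(s, ω)` such that the weight of the path is at most `m` at all rational times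
before `s`. -/
def boundedPast {Ω : Type*} {d : ℕ} (L : ℝ≥0 → Ω → (Fin d → ℝ)) (m : ℕ) : Set (ℝ≥0 × Ω) :=
  {p | ∀ q : ℚ, (q : ℝ).toNNReal < p.1 → momentWeight (L (q : ℝ).toNNReal p.2) ≤ m}

/-- The set of `(s, ω)` such that the weight of the path is at most `m` at time `s` and at all
rational times before `s`. -/
def boundedUpTo {Ω : Type*} {d : ℕ} (L : ℝ≥0 → Ω → (Fin d → ℝ)) (m : ℕ) : Set (ℝ≥0 × Ω) :=
  boundedPast L m ∩ {p | momentWeight (L p.1 p.2) ≤ m}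

theorem mem_boundedPast_of_le {m : ℕ} {s t : ℝ≥0} {ω : Ω} (hst : s ≤ t)
    (h : (t, ω) ∈ boundedPast L m) : (s, ω) ∈ boundedPast L m :=
  fun q hq => h q (lt_of_lt_of_le hq hst)

namespace IsSelfExcitingJumpProcess

section General

variable (hL : IsSelfExcitingJumpProcess P 𝓕 μ B κ x₀ T X Y L)
include hL

/-- Restricting to rational times makes this a countable intersection of complements of predictable
rectangles `(q, ∞) × A`. The set replaces a localizing stopping time. -/
theorem measurableSet_boundedPast (m : ℕ) : MeasurableSet[𝓕.predictable] (boundedPast L m) := by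
  have : boundedPast L m = ⋂ q : ℚ, (Ioi (q : ℝ).toNNReal ×ˢ
      {ω | (m : ℝ) < momentWeight (L (q : ℝ).toNNReal ω)})ᶜ := by
    ext ⟨s, ω⟩
    simp [boundedPast]
  rw [this]
  refine @MeasurableSet.iInter _ _ 𝓕.predictable _ _ fun q =>
    @MeasurableSet.compl _ _ 𝓕.predictable (measurableSet_predictable_Ioi_prod ?_)
  have h := continuous_momentWeight.measurable.comp (hL.intensity_adapted (q : ℝ).toNNReal)
  exact h measurableSet_Ioi

theorem measurable_momentWeight_uncurry :
    Measurable fun p : ℝ≥0 × Ω => momentWeight (L p.1 p.2) :=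
  continuous_momentWeight.measurable.comp
    (measurable_pi_iff.2 fun i => hL.measurable_intensity_uncurry i)

theorem measurableSet_boundedUpTo (m : ℕ) : MeasurableSet (boundedUpTo L m) :=
  (predictable_le_prod 𝓕 _ (hL.measurableSet_boundedPast m)).inter
    (hL.measurable_momentWeight_uncurry measurableSet_Iic)

/-- At almost every `s` the path is left-continuous, so a weight above `m` at `s` would already be
above `m` at some earlier rational time. -/
theorem boundedPast_ae_iff (m : ℕ) (ω : Ω) : ∀ᵐ s : ℝ, 0 < s →
    ((s.toNNReal, ω) ∈ boundedPast L m ↔ (s.toNNReal, ω) ∈ boundedUpTo L m) := by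
  filter_upwards [hL.leftIntensity_ae_eq ω] with s hs hs0
  refine ⟨fun h => ⟨h, ?_⟩, fun h => h.1⟩
  by_contra hlt
  have hlt' : (m : ℝ) < momentWeight (L s.toNNReal ω) := not_le.1 hlt
  have htend : Tendsto (fun r => momentWeight (L r ω)) (𝓝[<] s.toNNReal)
      (𝓝 (momentWeight (L s.toNNReal ω))) := by
    refine (continuous_momentWeight.tendsto _).comp ?_
    rw [← hs]
    exact tendsto_pi_nhds.2 fun i => hL.tendsto_left s.toNNReal ω i
  have hev := htend.eventually (lt_mem_nhds hlt')
  obtain ⟨a, ha, hsub⟩ := (mem_nhdsLT_iff_exists_Ioo_subset' (Real.toNNReal_pos.2 hs0)).1 hev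
  obtain ⟨q, hq1, hq2⟩ := exists_rat_btwn (NNReal.coe_lt_coe.2 ha)
  have hq0 : (0 : ℝ) ≤ q := a.2.trans hq1.le
  have hqa : a < (q : ℝ).toNNReal := by
    rw [← NNReal.coe_lt_coe, Real.coe_toNNReal _ hq0]; exact hq1
  have hqs : (q : ℝ).toNNReal < s.toNNReal := by
    rw [← NNReal.coe_lt_coe, Real.coe_toNNReal _ hq0]; exact hq2
  exact absurd (h q hqs) (not_le.2 (hsub ⟨hqa, hqs⟩))

theorem eventually_mem_boundedUpTo (t : ℝ≥0) (ω : Ω) :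
    ∀ᶠ m : ℕ in atTop, (t, ω) ∈ boundedUpTo L m := by
  obtain ⟨C, hC⟩ := hL.exists_path_bound t ω
  have hb : ∀ s ≤ t, momentWeight (L s ω) ≤ 1 + d * C ^ 2 := by
    intro s hs
    unfold momentWeight
    refine add_le_add le_rfl ?_
    calc ∑ i, L s ω i ^ 2 ≤ ∑ _i : Fin d, C ^ 2 := Finset.sum_le_sum fun i _ => by
          rw [← sq_abs]; exact pow_le_pow_left₀ (abs_nonneg _) (hC s hs i) 2
      _ = _ := by simp
  filter_upwards [eventually_ge_atTop ⌈1 + d * C ^ 2⌉₊] with m hm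
  have hm' : 1 + d * C ^ 2 ≤ m := (Nat.le_ceil _).trans (by exact_mod_cast hm)
  exact ⟨fun q hq => (hb _ hq.le).trans hm', (hb t le_rfl).trans hm'⟩

end General

variable (hL : IsSelfExcitingJumpProcess P 𝓕 (fun _ x => A *ᵥ (x - l₀)) B κ x₀ T X Y L)
include hL

/-- A pathwise bound for the weight by its drift and jump contributions. -/
theorem momentWeight_le {t : ℝ≥0} {ω : Ω} {I : Finset ℕ} (hI : ∀ n, n ∈ I ↔ T n ω ≤ t) :
    ENNReal.ofReal (momentWeight (L t ω)) ≤ ENNReal.ofReal (momentWeight x₀) +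
      d * ((∫⁻ s in Ioc (0 : ℝ) t, ENNReal.ofReal
          (2 * driftBound A l₀ * momentWeight (L s.toNNReal ω))) +
        ∑ n ∈ I, (ENNReal.ofReal (2 * (∑ i, ∑ k, |B i k|) *
            ∑ i, |leftIntensity (fun _ x => A *ᵥ (x - l₀)) B x₀ T X Y L (T n ω).toNNReal ω i|) *
          ENNReal.ofReal (Y n (X n ω) ω) +
          ENNReal.ofReal ((∑ i, ∑ k, |B i k|) ^ 2) * ENNReal.ofReal (Y n (X n ω) ω ^ 2))) := by
  set β := ∑ i, ∑ k, |B i k| with hβ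
  set lam := leftIntensity (fun _ x => A *ᵥ (x - l₀)) B x₀ T X Y L with hlam
  have hBβ : ∀ i k, |B i k| ≤ β := fun i k =>
    (Finset.single_le_sum (f := fun k => |B i k|) (fun _ _ => abs_nonneg _)
      (Finset.mem_univ k)).trans (Finset.single_le_sum (f := fun i => ∑ k, |B i k|)
        (fun _ _ => Finset.sum_nonneg fun _ _ => abs_nonneg _) (Finset.mem_univ i))
  have hβ0 : 0 ≤ β := Finset.sum_nonneg fun _ _ => Finset.sum_nonneg fun _ _ => abs_nonneg _
  set R := (∫⁻ s in Ioc (0 : ℝ) t, ENNReal.ofReal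
          (2 * driftBound A l₀ * momentWeight (L s.toNNReal ω))) +
        ∑ n ∈ I, (ENNReal.ofReal (2 * β * ∑ i, |lam (T n ω).toNNReal ω i|) *
          ENNReal.ofReal (Y n (X n ω) ω) +
          ENNReal.ofReal (β ^ 2) * ENNReal.ofReal (Y n (X n ω) ω ^ 2)) with hR
  -- The remainder `R` does not depend on `i`; summing over coordinates produces the factor `d`.
  have hi : ∀ i, ENNReal.ofReal (L t ω i ^ 2) ≤ ENNReal.ofReal (x₀ i ^ 2) + R := by
    intro i
    rw [pow_two, hL.mul_eq hI i i, pow_two, hR, ← add_assoc]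
    refine ENNReal.ofReal_add_le.trans (add_le_add (ENNReal.ofReal_add_le.trans
      (add_le_add le_rfl ?_)) ?_)
    · rw [intervalIntegral.integral_of_le t.coe_nonneg]
      refine (Real.ofReal_le_enorm _).trans ((enorm_integral_le_lintegral_enorm _).trans ?_)
      refine lintegral_mono fun s => ?_
      rw [Real.enorm_eq_ofReal_abs]
      refine ENNReal.ofReal_le_ofReal ((abs_add_le _ _).trans ?_)
      have h := abs_drift_mul_le (L s.toNNReal ω) A l₀ i i
      rw [mul_comm (L s.toNNReal ω i)]
      linarith
    · let J : ℕ → ℝ := fun n => (2 * β * ∑ i, |lam (T n ω).toNNReal ω i|) * Y n (X n ω) ω +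
        β ^ 2 * Y n (X n ω) ω ^ 2
      refine ((ENNReal.ofReal_le_ofReal (Finset.sum_le_sum (g := J) fun n _ => ?_)).trans
        (ENNReal.ofReal_sum_of_nonneg (f := J) fun n _ => ?_).le).trans
        (Finset.sum_le_sum fun n _ => ?_)
      · have hY := hL.size_nonneg n (X n ω) ω
        have hl : |lam (T n ω).toNNReal ω i| ≤ ∑ i, |lam (T n ω).toNNReal ω i| :=
          Finset.single_le_sum (f := fun i => |lam (T n ω).toNNReal ω i|)
            (fun _ _ => abs_nonneg _) (Finset.mem_univ i)
        have h1 : lam (T n ω).toNNReal ω i * B i (X n ω) ≤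
            β * ∑ i, |lam (T n ω).toNNReal ω i| := by
          refine (le_abs_self _).trans ?_
          rw [abs_mul, mul_comm]
          exact mul_le_mul (hBβ _ _) hl (abs_nonneg _) hβ0
        have h2 : B i (X n ω) ^ 2 ≤ β ^ 2 := by
          rw [← sq_abs]; exact pow_le_pow_left₀ (abs_nonneg _) (hBβ _ _) 2
        simp only [J]
        have h3 := mul_le_mul_of_nonneg_right h1 hY
        have h4 := mul_le_mul_of_nonneg_right h2 (sq_nonneg (Y n (X n ω) ω))
        nlinarith [h3, h4]
      · have hY := hL.size_nonneg n (X n ω) ω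
        simp only [J]
        have : 0 ≤ ∑ i, |lam (T n ω).toNNReal ω i| := Finset.sum_nonneg fun _ _ => abs_nonneg _
        positivity
      · rw [← ENNReal.ofReal_mul' (hL.size_nonneg _ _ _), ← ENNReal.ofReal_mul' (sq_nonneg _)]
        exact ENNReal.ofReal_add_le
  unfold momentWeight
  rw [ENNReal.ofReal_add zero_le_one (Finset.sum_nonneg fun _ _ => sq_nonneg _),
    ENNReal.ofReal_add zero_le_one (Finset.sum_nonneg fun _ _ => sq_nonneg _),
    ENNReal.ofReal_sum_of_nonneg fun _ _ => sq_nonneg _,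
    ENNReal.ofReal_sum_of_nonneg fun _ _ => sq_nonneg _, add_assoc]
  refine add_le_add le_rfl ((Finset.sum_le_sum fun i _ => hi i).trans_eq ?_)
  rw [Finset.sum_add_distrib]
  simp

end IsSelfExcitingJumpProcess

end Truncation

/-! ### Gronwall bound for the second moments -/

section MomentBound

variable {Ω : Type*} {mΩ : MeasurableSpace Ω} {P : Measure Ω}
  {𝓕 : Filtration ℝ≥0 mΩ} {d : ℕ} {μ : ℝ → (Fin d → ℝ) → (Fin d → ℝ)}
  {A B : Matrix (Fin d) (Fin d) ℝ} {κ : Fin d → Kernel (Fin d → ℝ) ℝ} {l₀ x₀ : Fin d → ℝ}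
  {T : ℕ → Ω → ℝ≥0∞} {X : ℕ → Ω → Fin d} {Y : ℕ → Fin d → Ω → ℝ} {L : ℝ≥0 → Ω → (Fin d → ℝ)}

/-- The weight of the intensity, truncated to the event that it has stayed below `m`. -/
noncomputable def truncatedWeight {Ω : Type*} {d : ℕ} (L : ℝ≥0 → Ω → (Fin d → ℝ)) (m : ℕ) :
    ℝ≥0 × Ω → ℝ≥0∞ :=
  (boundedUpTo L m).indicator fun p => ENNReal.ofReal (momentWeight (L p.1 p.2))

theorem truncatedWeight_le (m : ℕ) (p : ℝ≥0 × Ω) : truncatedWeight L m p ≤ ENNReal.ofReal m := by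
  unfold truncatedWeight
  by_cases h : p ∈ boundedUpTo L m
  · rw [indicator_of_mem h]
    exact ENNReal.ofReal_le_ofReal h.2
  · rw [indicator_of_notMem h]; exact zero_le

namespace IsSelfExcitingJumpProcess

theorem measurable_truncatedWeight (hL : IsSelfExcitingJumpProcess P 𝓕 μ B κ x₀ T X Y L) (m : ℕ) :
    Measurable (truncatedWeight L m) :=
  hL.measurable_momentWeight_uncurry.ennreal_ofReal.indicator (hL.measurableSet_boundedUpTo m)

/-- Compensation needs the predictable set `boundedPast`, Gronwall the set `boundedUpTo`, on which
the current weight is bounded too. They agree at almost every time, so Tonelli lets one replace the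
other. -/
theorem lintegral_le_truncatedWeight [SFinite P]
    (hL : IsSelfExcitingJumpProcess P 𝓕 μ B κ x₀ T X Y L)
    (m : ℕ) {F : ℝ≥0 × Ω → ℝ≥0∞} (c : ℝ≥0∞) (t : ℝ)
    (hF : ∀ ω, ∀ᵐ s : ℝ, 0 < s → (s.toNNReal, ω) ∈ boundedUpTo L m →
      F (s.toNNReal, ω) ≤ c * ENNReal.ofReal (momentWeight (L s.toNNReal ω))) :
    ∫⁻ ω, (∫⁻ s in Ioc 0 t, (boundedPast L m).indicator F (s.toNNReal, ω)) ∂P ≤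
      c * ∫⁻ s in Ioc 0 t, (∫⁻ ω, truncatedWeight L m (s.toNNReal, ω) ∂P) := by
  have hm : Measurable fun p : Ω × ℝ => truncatedWeight L m (p.2.toNNReal, p.1) :=
    (hL.measurable_truncatedWeight m).comp (measurable_snd.real_toNNReal.prodMk measurable_fst)
  have hswap := lintegral_lintegral_swap (μ := P) (ν := volume.restrict (Ioc 0 t))
    (f := fun ω s => truncatedWeight L m (s.toNNReal, ω)) hm.aemeasurable
  rw [← hswap, ← lintegral_const_mul _ hm.lintegral_prod_right']
  refine lintegral_mono fun ω => ?_
  have hmω : Measurable fun s : ℝ => truncatedWeight L m (s.toNNReal, ω) :=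
    hm.comp (measurable_prodMk_left (x := ω))
  refine le_of_le_of_eq ?_ (lintegral_const_mul c hmω)
  refine lintegral_mono_ae ((ae_restrict_iff' measurableSet_Ioc).2 ?_)
  filter_upwards [hF ω, hL.boundedPast_ae_iff m ω] with s h1 h2 hs
  unfold truncatedWeight
  by_cases h : (s.toNNReal, ω) ∈ boundedPast L m
  · have h' := (h2 hs.1).1 h
    rw [indicator_of_mem h, indicator_of_mem h']
    exact h1 hs.1 h'
  · rw [indicator_of_notMem h]; exact zero_le

/-- If the path is bounded up to `t`, then all earlier times lie in `boundedPast`, so its indicator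
can be inserted into `momentWeight_le`; otherwise the left side is zero. -/
theorem truncatedWeight_path_le
    (hL : IsSelfExcitingJumpProcess P 𝓕 (fun _ x => A *ᵥ (x - l₀)) B κ x₀ T X Y L)
    (m : ℕ) (t : ℝ≥0) (ω : Ω) : truncatedWeight L m (t, ω) ≤
      ENNReal.ofReal (momentWeight x₀) + d * ((∫⁻ s in Ioc (0 : ℝ) t, (boundedPast L m).indicator
        (fun p => ENNReal.ofReal (2 * driftBound A l₀ * momentWeight (L p.1 p.2)))
          (s.toNNReal, ω)) +
        ∑ k, (markedSum T X Y k ((Iic t ×ˢ univ).indicator ((boundedPast L m).indicator fun p =>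
            ENNReal.ofReal (2 * (∑ i, ∑ k, |B i k|) * ∑ i,
              |leftIntensity (fun _ x => A *ᵥ (x - l₀)) B x₀ T X Y L p.1 p.2 i|)))
            (fun y => ENNReal.ofReal y) ω +
          markedSum T X Y k ((Iic t ×ˢ univ).indicator ((boundedPast L m).indicator fun _ =>
            ENNReal.ofReal ((∑ i, ∑ k, |B i k|) ^ 2)))
            (fun y => ENNReal.ofReal (y ^ 2)) ω)) := by
  by_cases h : (t, ω) ∈ boundedUpTo L m
  swap
  · rw [truncatedWeight, indicator_of_notMem h]; exact zero_le
  rw [truncatedWeight, indicator_of_mem h]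
  obtain ⟨I, hI⟩ := hL.exists_events t ω
  refine (hL.momentWeight_le hI).trans (add_le_add le_rfl (mul_le_mul_right ?_ _))
  refine add_le_add (setLIntegral_mono' measurableSet_Ioc fun s hs => ?_) (le_of_eq ?_)
  · rw [indicator_of_mem (mem_boundedPast_of_le (Real.toNNReal_le_iff_le_coe.2 hs.2) h.1)]
  · have key : ∀ f : Fin d → ℕ → ℝ≥0∞,
        ∑ k, ∑ n ∈ I, (if X n ω = k then f k n else 0) = ∑ n ∈ I, f (X n ω) n := by
      intro f
      rw [Finset.sum_comm]
      simp
    simp only [markedSum_indicator_Iic hI]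
    rw [Finset.sum_add_distrib, Finset.sum_add_distrib, key, key]
    have hmem : ∀ n ∈ I, ((T n ω).toNNReal, ω) ∈ boundedPast L m := fun n hn =>
      mem_boundedPast_of_le ((ENNReal.toNNReal_mono ENNReal.coe_ne_top
        ((hI n).1 hn)).trans_eq (ENNReal.toNNReal_coe t)) h.1
    congr 1 <;> refine Finset.sum_congr rfl fun n hn => ?_ <;>
      rw [indicator_of_mem (hmem n hn)]

/-- After compensation each jump term is at most quadratic in `λ`: the integrand is at most linear
in the left limit and the intensity adds one factor `λ_k`. Everything is thus bounded by the
truncated weight itself, with constants free of `m`, and Gronwall followed by Fatou concludes. -/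
theorem exists_moment_bound [IsProbabilityMeasure P]
    {ν : Fin d → Measure ℝ} [∀ k, IsProbabilityMeasure (ν k)]
    (hL : IsSelfExcitingJumpProcess P 𝓕 (fun _ x => A *ᵥ (x - l₀)) B κ x₀ T X Y L)
    (hk : ∀ k x, κ k x = ν k) (hν : ∀ k, Integrable (fun x : ℝ => x ^ 2) (ν k)) :
    ∃ C, 0 ≤ C ∧ ∀ t : ℝ≥0, ∫⁻ ω, ENNReal.ofReal (momentWeight (L t ω)) ∂P ≤
      ENNReal.ofReal (momentWeight x₀ * Real.exp (C * t)) := by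
  set β := ∑ i, ∑ k, |B i k| with hβ
  have hβ0 : 0 ≤ β := Finset.sum_nonneg fun _ _ => Finset.sum_nonneg fun _ _ => abs_nonneg _
  have hx0 : 0 ≤ momentWeight x₀ := zero_le_one.trans (one_le_momentWeight x₀)
  set m₁ : Fin d → ℝ≥0∞ := fun k => ∫⁻ y, ENNReal.ofReal y ∂(ν k) with hm₁
  set m₂ : Fin d → ℝ≥0∞ := fun k => ∫⁻ y, ENNReal.ofReal (y ^ 2) ∂(ν k) with hm₂
  have hm₂fin : ∀ k, m₂ k ≠ ∞ := by
    intro k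
    refine ((lintegral_mono fun y => ?_).trans_lt (hν k).2).ne
    rw [Real.enorm_eq_ofReal_abs]
    exact ENNReal.ofReal_le_ofReal (le_abs_self _)
  have hm₁fin : ∀ k, m₁ k ≠ ∞ := by
    intro k
    have : m₁ k ≤ 1 + m₂ k := by
      calc m₁ k ≤ ∫⁻ y, (1 + ENNReal.ofReal (y ^ 2)) ∂(ν k) := lintegral_mono fun y => by
            rw [← ENNReal.ofReal_one, ← ENNReal.ofReal_add zero_le_one (sq_nonneg _)]
            exact ENNReal.ofReal_le_ofReal (by nlinarith [sq_nonneg (y - 1)])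
        _ = 1 + m₂ k := by rw [lintegral_add_left measurable_const]; simp [hm₂]
    exact (this.trans_lt (ENNReal.add_lt_top.2 ⟨ENNReal.one_lt_top, (hm₂fin k).lt_top⟩)).ne
  -- The summands bound the drift, the cross terms `λ₋ Δλ` and the squared jumps. The inner `d`
  -- comes from `∑ᵢ |λᵢ| λ_k ≤ d * momentWeight`.
  set Ct : ℝ≥0∞ := d * (ENNReal.ofReal (2 * driftBound A l₀) +
    ∑ k, (m₁ k * ENNReal.ofReal (2 * β * d) + m₂ k * ENNReal.ofReal (β ^ 2))) with hCt
  have hCfin : Ct ≠ ∞ := by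
    refine ENNReal.mul_ne_top (ENNReal.natCast_ne_top d) (ENNReal.add_ne_top.2
      ⟨ENNReal.ofReal_ne_top, ENNReal.sum_ne_top.2 fun k _ => ENNReal.add_ne_top.2 ⟨?_, ?_⟩⟩)
    · exact ENNReal.mul_ne_top (hm₁fin k) ENNReal.ofReal_ne_top
    · exact ENNReal.mul_ne_top (hm₂fin k) ENNReal.ofReal_ne_top
  set lam := leftIntensity (fun _ x => A *ᵥ (x - l₀)) B x₀ T X Y L with hlam
  have hKp : ∀ m, MeasurableSet[𝓕.predictable] (boundedPast L m) := hL.measurableSet_boundedPast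
  have hstep : ∀ (m : ℕ) (t : ℝ≥0), ∫⁻ ω, truncatedWeight L m (t, ω) ∂P ≤
      ENNReal.ofReal (momentWeight x₀) +
        Ct * ∫⁻ s in Ioc (0 : ℝ) t, (∫⁻ ω, truncatedWeight L m (s.toNNReal, ω) ∂P) := by
    intro m t
    set U := ∫⁻ s in Ioc (0 : ℝ) t, (∫⁻ ω, truncatedWeight L m (s.toNNReal, ω) ∂P) with hU
    set F₀ : ℝ≥0 × Ω → ℝ≥0∞ :=
      fun p => ENNReal.ofReal (2 * driftBound A l₀ * momentWeight (L p.1 p.2)) with hF₀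
    set H₁ : ℝ≥0 × Ω → ℝ≥0∞ := (boundedPast L m).indicator fun p =>
      ENNReal.ofReal (2 * β * ∑ i, |lam p.1 p.2 i|) with hH₁
    set H₂ : ℝ≥0 × Ω → ℝ≥0∞ := (boundedPast L m).indicator fun _ => ENNReal.ofReal (β ^ 2) with hH₂
    have hH₁m : Measurable[𝓕.predictable] H₁ := by
      refine Measurable.indicator (mβ := inferInstance) ?_ (hKp m)
      refine ENNReal.measurable_ofReal.comp (Measurable.const_mul ?_ _)
      exact Finset.measurable_fun_sum _ fun i _ => 
        continuous_abs.measurable.comp (hL.measurable_leftIntensity i)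
    have hH₂m : Measurable[𝓕.predictable] H₂ :=
      Measurable.indicator (mβ := inferInstance) (@measurable_const _ _ _ 𝓕.predictable _) (hKp m)
    have hF₀m : Measurable ((boundedPast L m).indicator F₀) :=
      (hL.measurable_momentWeight_uncurry.const_mul _).ennreal_ofReal.indicator
        (predictable_le_prod 𝓕 _ (hKp m))
    have hid : Measurable fun y : ℝ => ENNReal.ofReal y := ENNReal.measurable_ofReal
    have hsq : Measurable fun y : ℝ => ENNReal.ofReal (y ^ 2) :=
      (measurable_id.pow_const 2).ennreal_ofReal
    have hpm : Measurable fun p : Ω × ℝ => (p.2.toNNReal, p.1) :=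
      measurable_snd.real_toNNReal.prodMk measurable_fst
    have hmk : ∀ k, Measurable fun p : Ω × ℝ => ENNReal.ofReal (L p.2.toNNReal p.1 k) := fun k =>
      (hL.measurable_intensity_real k).ennreal_ofReal
    have e0 : ∫⁻ ω, (∫⁻ s in Ioc (0 : ℝ) t, (boundedPast L m).indicator F₀ (s.toNNReal, ω)) ∂P ≤
        ENNReal.ofReal (2 * driftBound A l₀) * U := by
      refine hL.lintegral_le_truncatedWeight m _ t fun ω => ae_of_all _ fun s _ _ => ?_
      rw [← ENNReal.ofReal_mul (mul_nonneg zero_le_two (driftBound_nonneg A l₀))]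
    have e1 : ∀ k, ∫⁻ ω, markedSum T X Y k ((Iic t ×ˢ univ).indicator H₁)
        (fun y => ENNReal.ofReal y) ω ∂P ≤ m₁ k * ENNReal.ofReal (2 * β * d) * U := by
      intro k
      rw [hL.lintegral_markedSum_Iic k (hk k) hH₁m hid t, mul_assoc]
      refine mul_le_mul_right ?_ _
      have hmeas : Measurable fun p : Ω × ℝ =>
          H₁ (p.2.toNNReal, p.1) * ENNReal.ofReal (L p.2.toNNReal p.1 k) :=
        ((hH₁m.mono (predictable_le_prod 𝓕) le_rfl).comp hpm).mul (hmk k)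
      rw [lintegral_prod _ hmeas.aemeasurable]
      have := hL.lintegral_le_truncatedWeight m (F := fun p =>
        ENNReal.ofReal (2 * β * ∑ i, |lam p.1 p.2 i|) * ENNReal.ofReal (L p.1 p.2 k))
        (ENNReal.ofReal (2 * β * d)) t (fun ω => ?_)
      · refine le_trans (le_of_eq ?_) this
        refine lintegral_congr fun ω => lintegral_congr fun s => ?_
        rw [hH₁]
        simp only [indicator]
        split_ifs <;> simp
      · filter_upwards [hL.leftIntensity_ae_eq ω] with s hs _ _
        simp only [hlam, hs]
        rw [← ENNReal.ofReal_mul' (hL.intensity_nonneg _ _ _),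
          ← ENNReal.ofReal_mul (p := 2 * β * d) (by positivity)]
        refine ENNReal.ofReal_le_ofReal ?_
        rw [mul_assoc (2 * β), mul_assoc (2 * β)]
        refine mul_le_mul_of_nonneg_left ?_ (by positivity)
        rw [Finset.sum_mul]
        calc _ ≤ ∑ _i : Fin d, momentWeight (L s.toNNReal ω) := Finset.sum_le_sum fun i _ => by
              refine le_trans ?_ (abs_mul_le_momentWeight (L s.toNNReal ω) i k)
              exact mul_le_mul_of_nonneg_left (le_abs_self _) (abs_nonneg _)
          _ = _ := by simp
    have e2 : ∀ k, ∫⁻ ω, markedSum T X Y k ((Iic t ×ˢ univ).indicator H₂)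
        (fun y => ENNReal.ofReal (y ^ 2)) ω ∂P ≤ m₂ k * ENNReal.ofReal (β ^ 2) * U := by
      intro k
      rw [hL.lintegral_markedSum_Iic k (hk k) hH₂m hsq t, mul_assoc]
      refine mul_le_mul_right ?_ _
      have hmeas : Measurable fun p : Ω × ℝ =>
          H₂ (p.2.toNNReal, p.1) * ENNReal.ofReal (L p.2.toNNReal p.1 k) :=
        ((hH₂m.mono (predictable_le_prod 𝓕) le_rfl).comp hpm).mul (hmk k)
      rw [lintegral_prod _ hmeas.aemeasurable]
      have := hL.lintegral_le_truncatedWeight m (F := fun p =>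
        ENNReal.ofReal (β ^ 2) * ENNReal.ofReal (L p.1 p.2 k))
        (ENNReal.ofReal (β ^ 2)) t (fun ω => ae_of_all _ fun s _ _ => ?_)
      · refine le_trans (le_of_eq ?_) this
        refine lintegral_congr fun ω => lintegral_congr fun s => ?_
        rw [hH₂]
        simp only [indicator]
        split_ifs <;> simp
      · exact mul_le_mul_right (ENNReal.ofReal_le_ofReal
          ((le_abs_self _).trans (abs_le_momentWeight _ k))) _
    have hm1 : ∀ k, Measurable (markedSum T X Y k ((Iic t ×ˢ univ).indicator H₁)
        (fun y => ENNReal.ofReal y)) := fun k => measurable_markedSum hL k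
      ((measurable_indicator_Iic hH₁m t).mono (predictable_le_prod 𝓕) le_rfl) hid
    have hm2 : ∀ k, Measurable (markedSum T X Y k ((Iic t ×ˢ univ).indicator H₂)
        (fun y => ENNReal.ofReal (y ^ 2))) := fun k => measurable_markedSum hL k
      ((measurable_indicator_Iic hH₂m t).mono (predictable_le_prod 𝓕) le_rfl) hsq
    have hm0 : Measurable fun ω => ∫⁻ s in Ioc (0 : ℝ) t,
        (boundedPast L m).indicator F₀ (s.toNNReal, ω) :=
      (hF₀m.comp hpm).lintegral_prod_right'
    have hm12 : ∀ k, Measurable fun ω => markedSum T X Y k ((Iic t ×ˢ univ).indicator H₁)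
        (fun y => ENNReal.ofReal y) ω + markedSum T X Y k ((Iic t ×ˢ univ).indicator H₂)
        (fun y => ENNReal.ofReal (y ^ 2)) ω := fun k => (hm1 k).add (hm2 k)
    have hmsum : Measurable fun ω => (∫⁻ s in Ioc (0 : ℝ) t,
        (boundedPast L m).indicator F₀ (s.toNNReal, ω)) +
        ∑ k, (markedSum T X Y k ((Iic t ×ˢ univ).indicator H₁) (fun y => ENNReal.ofReal y) ω +
          markedSum T X Y k ((Iic t ×ˢ univ).indicator H₂) (fun y => ENNReal.ofReal (y ^ 2)) ω) :=
      hm0.add (Finset.measurable_fun_sum _ fun k _ => hm12 k)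
    refine (lintegral_mono fun ω => hL.truncatedWeight_path_le m t ω).trans ?_
    rw [lintegral_add_left measurable_const, lintegral_const, measure_univ, mul_one,
      lintegral_const_mul _ hmsum,
      lintegral_add_left hm0, lintegral_finsetSum _ fun k _ => hm12 k]
    refine add_le_add le_rfl ?_
    rw [hCt, mul_assoc]
    refine mul_le_mul_right ?_ _
    rw [add_mul, Finset.sum_mul]
    refine add_le_add e0 (Finset.sum_le_sum fun k _ => ?_)
    rw [lintegral_add_left (hm1 k), add_mul]
    exact add_le_add (e1 k) (e2 k)
  refine ⟨Ct.toReal, ENNReal.toReal_nonneg, fun t => ?_⟩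
  have hbound : ∀ m : ℕ, ∫⁻ ω, truncatedWeight L m (t, ω) ∂P ≤
      ENNReal.ofReal (momentWeight x₀ * Real.exp (Ct.toReal * t)) := by
    intro m
    have := le_exp_of_le_add_lintegral (u := fun s => ∫⁻ ω, truncatedWeight L m (s.toNNReal, ω) ∂P)
      hx0 (ENNReal.toReal_nonneg (a := Ct)) (Nat.cast_nonneg m) (fun s _ => ?_) (fun s hs => ?_)
      t t.coe_nonneg
    · simpa using this
    · calc _ ≤ ∫⁻ _ω, ENNReal.ofReal m ∂P := lintegral_mono fun ω => truncatedWeight_le m _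
        _ = _ := by simp
    · have := hstep m s.toNNReal
      rwa [Real.coe_toNNReal s hs, ← ENNReal.ofReal_toReal hCfin] at this
  have hlim : ∀ ω, Tendsto (fun m => truncatedWeight L m (t, ω)) atTop
      (𝓝 (ENNReal.ofReal (momentWeight (L t ω)))) := by
    intro ω
    refine tendsto_const_nhds.congr' ?_
    filter_upwards [hL.eventually_mem_boundedUpTo t ω] with m hm
    rw [truncatedWeight, indicator_of_mem hm]
  -- For each path the truncation is eventually inactive, since paths are bounded on `[0, t]`; Fatou
  -- then transfers the uniform bound.
  calc ∫⁻ ω, ENNReal.ofReal (momentWeight (L t ω)) ∂P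
      = ∫⁻ ω, liminf (fun m => truncatedWeight L m (t, ω)) atTop ∂P :=
        lintegral_congr fun ω => (hlim ω).liminf_eq.symm
    _ ≤ liminf (fun m => ∫⁻ ω, truncatedWeight L m (t, ω) ∂P) atTop :=
        lintegral_liminf_le fun m => (hL.measurable_truncatedWeight m).comp measurable_prodMk_left
    _ ≤ _ := by
        refine liminf_le_of_le (by isBoundedDefault) fun b hb => ?_
        obtain ⟨m, hm⟩ := hb.exists
        exact hm.trans (hbound m)

end IsSelfExcitingJumpProcess

end MomentBound

/-! ### Dynkin's formula and the moment equations -/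

section Dynkin

variable {Ω : Type*} {mΩ : MeasurableSpace Ω} {P : Measure Ω}
  {𝓕 : Filtration ℝ≥0 mΩ} {d : ℕ}
  {A B : Matrix (Fin d) (Fin d) ℝ} {κ : Fin d → Kernel (Fin d → ℝ) ℝ} {l₀ x₀ : Fin d → ℝ}
  {ν : Fin d → Measure ℝ} [∀ k, IsProbabilityMeasure (ν k)]
  {T : ℕ → Ω → ℝ≥0∞} {X : ℕ → Ω → Fin d} {Y : ℕ → Fin d → Ω → ℝ} {L : ℝ≥0 → Ω → (Fin d → ℝ)}

/-- The sum `∑ₙ 1{X_n = k, T_n ≤ t} H(T_n) φ(Y_n^k)` for a real-valued integrand. -/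
noncomputable def realMarkedSum {Ω : Type*} {d : ℕ} (T : ℕ → Ω → ℝ≥0∞) (X : ℕ → Ω → Fin d)
    (Y : ℕ → Fin d → Ω → ℝ) (k : Fin d) (t : ℝ≥0) (H : ℝ≥0 × Ω → ℝ) (φ : ℝ → ℝ) (ω : Ω) : ℝ :=
  ∑' n, if T n ω ≤ t then (if X n ω = k then H ((T n ω).toNNReal, ω) * φ (Y n k ω) else 0) else 0

theorem realMarkedSum_eq {t : ℝ≥0} {ω : Ω} {I : Finset ℕ} (hI : ∀ n, n ∈ I ↔ T n ω ≤ t)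
    (k : Fin d) (H : ℝ≥0 × Ω → ℝ) (φ : ℝ → ℝ) : realMarkedSum T X Y k t H φ ω =
      ∑ n ∈ I, if X n ω = k then H ((T n ω).toNNReal, ω) * φ (Y n k ω) else 0 := by
  unfold realMarkedSum
  rw [tsum_eq_sum fun n hn => if_neg fun h => hn ((hI n).2 h)]
  exact Finset.sum_congr rfl fun n hn => if_pos ((hI n).1 hn)

namespace IsSelfExcitingJumpProcess

variable (hL : IsSelfExcitingJumpProcess P 𝓕 (fun _ x => A *ᵥ (x - l₀)) B κ x₀ T X Y L)
  (hk : ∀ k x, κ k x = ν k) (hν : ∀ k, Integrable (fun x : ℝ => x ^ 2) (ν k))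
include hL

theorem ae_leftIntensity_eq [SFinite P] (t : ℝ) :
    ∀ᵐ p ∂(P.prod (volume.restrict (Ioc 0 t))),
      leftIntensity (fun _ x => A *ᵥ (x - l₀)) B x₀ T X Y L p.2.toNNReal p.1 =
        L p.2.toNNReal p.1 := by
  have hlm := hL.measurable_leftIntensity
  have hae := hL.leftIntensity_ae_eq
  generalize leftIntensity (fun _ x => A *ᵥ (x - l₀)) B x₀ T X Y L = lam at hlm hae ⊢
  have hpm : Measurable fun p : Ω × ℝ => (p.2.toNNReal, p.1) :=
    measurable_snd.real_toNNReal.prodMk measurable_fst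
  have hm : Measurable fun p : Ω × ℝ => lam p.2.toNNReal p.1 :=
    measurable_pi_iff.2 fun i => ((hlm i).mono (predictable_le_prod 𝓕) le_rfl).comp hpm
  exact (Measure.ae_prod_iff_ae_ae (measurableSet_eq_fun hm
    (measurable_pi_iff.2 hL.measurable_intensity_real))).2
    (ae_of_all _ fun ω => ae_restrict_of_ae (hae ω))

variable [IsProbabilityMeasure P]

include hk hν

theorem integrable_of_abs_le {p : (Fin d → ℝ) → ℝ} (hp : Continuous p) {c : ℝ}
    (hc : ∀ v, |p v| ≤ c * momentWeight v) (t : ℝ≥0) : Integrable (fun ω => p (L t ω)) P := by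
  obtain ⟨C, -, hC⟩ := hL.exists_moment_bound hk hν
  have hm : Measurable fun ω => L t ω := measurable_pi_iff.2 (hL.measurable_intensity_apply t)
  have hw : Integrable (fun ω => momentWeight (L t ω)) P := by
    refine ⟨(continuous_momentWeight.measurable.comp hm).aestronglyMeasurable, ?_⟩
    refine lt_of_le_of_lt (le_of_eq ?_) ((hC t).trans_lt ENNReal.ofReal_lt_top)
    exact lintegral_congr fun ω => Real.enorm_of_nonneg
      (zero_le_one.trans (one_le_momentWeight _))
  exact (hw.const_mul c).mono' (hp.measurable.comp hm).aestronglyMeasurable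
    (ae_of_all _ fun ω => hc _)

/-- The moment bound increases with time, so its value at the right endpoint dominates on `(0, t]`.
This is what justifies Fubini in `dynkin`. -/
theorem integrable_prod_of_abs_le {p : (Fin d → ℝ) → ℝ} (hp : Continuous p) {c : ℝ}
    (hc : ∀ v, |p v| ≤ c * momentWeight v) (t : ℝ) :
    Integrable (fun q : Ω × ℝ => p (L q.2.toNNReal q.1)) (P.prod (volume.restrict (Ioc 0 t))) := by
  obtain ⟨C, hC0, hC⟩ := hL.exists_moment_bound hk hν
  have hm : Measurable fun q : Ω × ℝ => L q.2.toNNReal q.1 :=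
    measurable_pi_iff.2 hL.measurable_intensity_real
  have hmw : Measurable fun q : Ω × ℝ => momentWeight (L q.2.toNNReal q.1) :=
    continuous_momentWeight.measurable.comp hm
  have hw : Integrable (fun q : Ω × ℝ => momentWeight (L q.2.toNNReal q.1))
      (P.prod (volume.restrict (Ioc 0 t))) := by
    refine ⟨hmw.aestronglyMeasurable, ?_⟩
    have e : ∫⁻ q : Ω × ℝ, ‖momentWeight (L q.2.toNNReal q.1)‖ₑ
        ∂(P.prod (volume.restrict (Ioc 0 t))) =
        ∫⁻ s in Ioc 0 t, (∫⁻ ω, ENNReal.ofReal (momentWeight (L s.toNNReal ω)) ∂P) := by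
      rw [lintegral_prod_symm' _ hmw.enorm]
      exact lintegral_congr fun s => lintegral_congr fun ω => Real.enorm_of_nonneg
        (zero_le_one.trans (one_le_momentWeight _))
    refine lt_of_le_of_lt e.le ?_
    calc _ ≤ ∫⁻ _s in Ioc 0 t, ENNReal.ofReal (momentWeight x₀ * Real.exp (C * t)) := by
          refine setLIntegral_mono' measurableSet_Ioc fun s hs => (hC _).trans ?_
          refine ENNReal.ofReal_le_ofReal (mul_le_mul_of_nonneg_left (Real.exp_le_exp.2 ?_)
            (zero_le_one.trans (one_le_momentWeight _)))
          rw [Real.coe_toNNReal s hs.1.le]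
          exact mul_le_mul_of_nonneg_left hs.2 hC0
      _ < ∞ := by
          rw [lintegral_const, Measure.restrict_apply MeasurableSet.univ, univ_inter,
            Real.volume_Ioc]
          exact ENNReal.mul_lt_top ENNReal.ofReal_lt_top ENNReal.ofReal_lt_top
  exact (hw.const_mul c).mono' (hp.measurable.comp hm).aestronglyMeasurable
    (ae_of_all _ fun q => hc _)

theorem intervalIntegrable_expectation {p : (Fin d → ℝ) → ℝ} (hp : Continuous p) {c : ℝ}
    (hc : ∀ v, |p v| ≤ c * momentWeight v) (t : ℝ≥0) :
    IntervalIntegrable (fun s : ℝ => ∫ ω, p (L s.toNNReal ω) ∂P) volume 0 t := by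
  rw [intervalIntegrable_iff, uIoc_of_le t.coe_nonneg]
  exact (hL.integrable_prod_of_abs_le hk hν hp hc t).integral_prod_right

theorem integral_prod_eq {p : (Fin d → ℝ) → ℝ} (hp : Continuous p) {c : ℝ}
    (hc : ∀ v, |p v| ≤ c * momentWeight v) (t : ℝ≥0) :
    ∫ q : Ω × ℝ, p (L q.2.toNNReal q.1) ∂(P.prod (volume.restrict (Ioc 0 (t : ℝ)))) =
      ∫ s in (0 : ℝ)..t, (∫ ω, p (L s.toNNReal ω) ∂P) := by
  rw [intervalIntegral.integral_of_le t.coe_nonneg,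
    integral_prod_symm _ (hL.integrable_prod_of_abs_le hk hν hp hc t)]

/-- Dynkin's formula for a function of the intensity whose path is the sum of a drift integral
with integrand `a` and jumps `h_k(L(T_n-)) Y_n^k + c_k (Y_n^k)²`. -/
theorem dynkin {f a p : (Fin d → ℝ) → ℝ} {h : Fin d → (Fin d → ℝ) → ℝ} {c : Fin d → ℝ} {f₀ K : ℝ}
    (ha : Continuous a) (hh : ∀ k, Continuous (h k))
    (haK : ∀ v, |a v| ≤ K * momentWeight v) (hhK : ∀ k v, |h k v * v k| ≤ K * momentWeight v)
    (hpeq : ∀ v, p v = a v + ∑ k, ((∫ y, y ∂(ν k)) * (h k v * v k) +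
      (∫ y, y ^ 2 ∂(ν k)) * (c k * v k)))
    (t : ℝ≥0) (hpath : ∀ ω (I : Finset ℕ), (∀ n, n ∈ I ↔ T n ω ≤ t) →
      f (L t ω) = f₀ + (∫ s in (0 : ℝ)..t, a (L s.toNNReal ω)) +
        ∑ n ∈ I, (h (X n ω) (leftIntensity (fun _ x => A *ᵥ (x - l₀)) B x₀ T X Y L
          (T n ω).toNNReal ω) * Y n (X n ω) ω + c (X n ω) * Y n (X n ω) ω ^ 2)) :
    Continuous p ∧ (∃ K', ∀ v, |p v| ≤ K' * momentWeight v) ∧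
      ∫ ω, f (L t ω) ∂P = f₀ + ∫ s in (0 : ℝ)..t, (∫ ω, p (L s.toNNReal ω) ∂P) := by
  set lam := leftIntensity (fun _ x => A *ᵥ (x - l₀)) B x₀ T X Y L with hlam
  set ρ := P.prod (volume.restrict (Ioc 0 (t : ℝ))) with hρ
  have hνi : ∀ k, Integrable (fun x : ℝ => x) (ν k) := fun k =>
    ((integrable_const (1 : ℝ)).add (hν k)).mono' measurable_id.aestronglyMeasurable
      (ae_of_all _ fun y => by
        simp only [Real.norm_eq_abs, Pi.add_apply]
        nlinarith [sq_abs y, sq_nonneg (|y| - 1)])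
  have hcK : ∀ k v, |c k * v k| ≤ |c k| * momentWeight v := fun k v => by
    rw [abs_mul]
    exact mul_le_mul_of_nonneg_left (abs_le_momentWeight v k) (abs_nonneg _)
  have hhc : ∀ k, Continuous fun v : Fin d → ℝ => h k v * v k := fun k =>
    (hh k).mul (continuous_apply k)
  have hcc : ∀ k, Continuous fun v : Fin d → ℝ => c k * v k := fun k =>
    continuous_const.mul (continuous_apply k)
  have hlamp : Measurable[𝓕.predictable] fun q : ℝ≥0 × Ω => lam q.1 q.2 :=
    @measurable_pi_lambda _ _ _ 𝓕.predictable _ _ fun i => hL.measurable_leftIntensity i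
  have hae := hL.ae_leftIntensity_eq t
  have hiA := hL.integrable_prod_of_abs_le hk hν ha haK t
  have hi1 := fun k => hL.integrable_prod_of_abs_le hk hν (hhc k) (hhK k) t
  have hi2 := fun k => hL.integrable_prod_of_abs_le hk hν (hcc k) (hcK k) t
  -- Predictability forces left limits inside `h`, but under `P ⊗ ds` they may be exchanged for
  -- current values.
  have hae1 : ∀ k, (fun q : Ω × ℝ => h k (L q.2.toNNReal q.1) * L q.2.toNNReal q.1 k) =ᵐ[ρ]
      fun q => h k (lam q.2.toNNReal q.1) * L q.2.toNNReal q.1 k := fun k => by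
    filter_upwards [hae] with q hq
    rw [hlam, hq]
  have h1 := fun k => hL.integral_markedSum k (hk k)
    (H := fun q => h k (lam q.1 q.2)) ((hh k).measurable.comp hlamp) (φ := fun y => y)
    measurable_id (fun _ hy => hy) (hνi k) t ((hi1 k).congr (hae1 k))
    (G := realMarkedSum T X Y k t (fun q => h k (lam q.1 q.2)) fun y => y)
    (fun ω I hI => realMarkedSum_eq hI k _ _)
  have h2 := fun k => hL.integral_markedSum k (hk k)
    (H := fun _ => c k) (@measurable_const _ _ _ 𝓕.predictable _) (φ := fun y => y ^ 2)
    (measurable_id.pow_const 2) (fun _ _ => sq_nonneg _) (hν k) t (hi2 k)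
    (G := realMarkedSum T X Y k t (fun _ => c k) fun y => y ^ 2)
    (fun ω I hI => realMarkedSum_eq hI k _ _)
  have hdec : ∀ ω, f (L t ω) = f₀ + (∫ s in Ioc (0 : ℝ) t, a (L s.toNNReal ω)) +
      ∑ k, (realMarkedSum T X Y k t (fun q => h k (lam q.1 q.2)) (fun y => y) ω +
        realMarkedSum T X Y k t (fun _ => c k) (fun y => y ^ 2) ω) := by
    intro ω
    obtain ⟨I, hI⟩ := hL.exists_events t ω
    rw [hpath ω I hI, intervalIntegral.integral_of_le t.coe_nonneg]
    congr 1
    have key : ∀ g : Fin d → ℕ → ℝ,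
        ∑ k, ∑ n ∈ I, (if X n ω = k then g k n else 0) = ∑ n ∈ I, g (X n ω) n := by
      intro g
      rw [Finset.sum_comm]
      simp
    simp only [realMarkedSum_eq hI]
    rw [Finset.sum_add_distrib, Finset.sum_add_distrib, key, key]
  have hpfun : p = fun v => a v + ∑ k, ((∫ y, y ∂(ν k)) * (h k v * v k) +
          (∫ y, y ^ 2 ∂(ν k)) * (c k * v k)) := funext hpeq
  have hpc : Continuous p := by
    rw [hpfun]
    exact ha.add (continuous_finsetSum _ fun k _ =>
      (continuous_const.mul (hhc k)).add (continuous_const.mul (hcc k)))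
  have hpK : ∀ v, |p v| ≤ (K + ∑ k, (|∫ y, y ∂(ν k)| * K + |∫ y, y ^ 2 ∂(ν k)| * |c k|)) *
      momentWeight v := by
    intro v
    rw [hpeq, add_mul, Finset.sum_mul]
    refine (abs_add_le _ _).trans (add_le_add (haK v)
      ((Finset.abs_sum_le_sum_abs _ _).trans (Finset.sum_le_sum fun k _ => ?_)))
    rw [add_mul, mul_assoc, mul_assoc]
    refine (abs_add_le _ _).trans ?_
    rw [abs_mul, abs_mul (∫ y, y ^ 2 ∂(ν k))]
    exact add_le_add (mul_le_mul_of_nonneg_left (hhK k v) (abs_nonneg _))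
      (mul_le_mul_of_nonneg_left (hcK k v) (abs_nonneg _))
  refine ⟨hpc, ⟨_, hpK⟩, ?_⟩
  rw [← hL.integral_prod_eq hk hν hpc hpK t]
  have hsumI : ∀ k ∈ (Finset.univ : Finset (Fin d)), Integrable (fun ω =>
      realMarkedSum T X Y k t (fun q => h k (lam q.1 q.2)) (fun y => y) ω +
        realMarkedSum T X Y k t (fun _ => c k) (fun y => y ^ 2) ω) P :=
    fun k _ => (h1 k).1.add (h2 k).1
  have hAint : Integrable (fun ω => ∫ s in Ioc (0 : ℝ) t, a (L s.toNNReal ω)) P :=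
    hiA.integral_prod_left
  have lhs : ∫ ω, f (L t ω) ∂P = f₀ + ∫ q : Ω × ℝ, a (L q.2.toNNReal q.1) ∂ρ +
      ∑ k, ((∫ y, y ∂(ν k)) * (∫ q : Ω × ℝ, h k (L q.2.toNNReal q.1) * L q.2.toNNReal q.1 k ∂ρ) +
        (∫ y, y ^ 2 ∂(ν k)) * (∫ q : Ω × ℝ, c k * L q.2.toNNReal q.1 k ∂ρ)) := by
    have hfA : Integrable (fun ω => f₀ + ∫ s in Ioc (0 : ℝ) t, a (L s.toNNReal ω)) P :=
      (integrable_const f₀).add hAint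
    rw [integral_congr_ae (ae_of_all _ hdec), integral_add hfA
      (integrable_finsetSum _ hsumI), integral_add (integrable_const f₀) hAint,
      integral_finsetSum _ hsumI, integral_prod _ hiA]
    congr 1
    · simp
    · refine Finset.sum_congr rfl fun k _ => ?_
      rw [integral_add (h1 k).1 (h2 k).1, (h1 k).2, (h2 k).2, integral_congr_ae (hae1 k)]
  have hterm : ∀ k ∈ (Finset.univ : Finset (Fin d)), Integrable (fun q : Ω × ℝ =>
      (∫ y, y ∂(ν k)) * (h k (L q.2.toNNReal q.1) * L q.2.toNNReal q.1 k) +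
        (∫ y, y ^ 2 ∂(ν k)) * (c k * L q.2.toNNReal q.1 k)) ρ :=
    fun k _ => ((hi1 k).const_mul _).add ((hi2 k).const_mul _)
  rw [lhs, hpfun, integral_add hiA (integrable_finsetSum _ hterm), integral_finsetSum _ hterm,
    add_assoc]
  congr 2
  refine Finset.sum_congr rfl fun k _ => ?_
  rw [integral_add ((hi1 k).const_mul _) ((hi2 k).const_mul _),
    integral_const_mul (∫ y, y ∂(ν k)), integral_const_mul (∫ y, y ^ 2 ∂(ν k))]

end IsSelfExcitingJumpProcess

end Dynkin

/-- First half of the bootstrap: integrability of `e` alone gives continuity of `g`. The next lemma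
upgrades continuity of `e` to differentiability of `g`. -/
theorem continuousOn_Ici_of_eq_integral {g e : ℝ → ℝ} {c : ℝ}
    (he : ∀ t : ℝ≥0, IntervalIntegrable e volume 0 t)
    (hg : ∀ t : ℝ, 0 ≤ t → g t = c + ∫ s in (0 : ℝ)..t, e s) : ContinuousOn g (Ici 0) := by
  intro t ht
  have ht0 : (0 : ℝ) ≤ t := ht
  have h1 : ContinuousOn (fun t => c + ∫ s in (0 : ℝ)..t, e s) (Icc 0 (t + 1)) :=
    continuousOn_const.add (continuousOn_primitive (he ⟨t + 1, by linarith⟩) (by linarith))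
  have h2 : ContinuousOn g (Icc 0 (t + 1)) := h1.congr fun s hs => hg s hs.1
  refine (h2 t ⟨ht0, by linarith⟩).mono_of_mem_nhdsWithin ?_
  rw [← Ici_inter_Iic]
  exact inter_mem self_mem_nhdsWithin (nhdsWithin_le_nhds (Iic_mem_nhds (by linarith)))

theorem hasDerivWithinAt_Ici_of_eq_integral {g e : ℝ → ℝ} {c : ℝ} (he : ContinuousOn e (Ici 0))
    (hg : ∀ t : ℝ, 0 ≤ t → g t = c + ∫ s in (0 : ℝ)..t, e s) {t : ℝ} (ht : 0 ≤ t) :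
    HasDerivWithinAt g (e t) (Ici 0) t := by
  -- Freezing `e` at its value at `0` for negative times gives a globally continuous integrand, so
  -- the fundamental theorem also covers the endpoint.
  have hc : Continuous fun s => e (max s 0) :=
    continuousOn_univ.1 (he.comp (by fun_prop) fun s _ => le_max_right s 0)
  have h1 := ((hc.integral_hasStrictDerivAt 0 t).hasDerivAt.const_add c).hasDerivWithinAt
    (s := Ici 0)
  rw [max_eq_left ht] at h1
  have heq : ∀ u : ℝ, 0 ≤ u → g u = c + ∫ s in (0 : ℝ)..u, e (max s 0) := by
    intro u hu
    rw [hg u hu]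
    congr 1
    refine intervalIntegral.integral_congr fun s hs => ?_
    rw [uIcc_of_le hu] at hs
    simp only [max_eq_left hs.1]
  exact h1.congr (fun u hu => heq u hu) (heq t ht)

/-! ### Integral equations for the mean and the second moments -/

section Moments

variable {Ω : Type*} {mΩ : MeasurableSpace Ω} {P : Measure Ω} [IsProbabilityMeasure P]
  {𝓕 : Filtration ℝ≥0 mΩ} {d : ℕ}
  {A B : Matrix (Fin d) (Fin d) ℝ} {κ : Fin d → Kernel (Fin d → ℝ) ℝ} {l₀ x₀ : Fin d → ℝ}
  {ν : Fin d → Measure ℝ} [∀ k, IsProbabilityMeasure (ν k)]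
  {T : ℕ → Ω → ℝ≥0∞} {X : ℕ → Ω → Fin d} {Y : ℕ → Fin d → Ω → ℝ} {L : ℝ≥0 → Ω → (Fin d → ℝ)}

theorem abs_entry_le_sum (B : Matrix (Fin d) (Fin d) ℝ) (i k : Fin d) :
    |B i k| ≤ ∑ i, ∑ k, |B i k| :=
  (Finset.single_le_sum (f := fun k => |B i k|) (fun _ _ => abs_nonneg _)
    (Finset.mem_univ k)).trans (Finset.single_le_sum (f := fun i => ∑ k, |B i k|)
      (fun _ _ => Finset.sum_nonneg fun _ _ => abs_nonneg _) (Finset.mem_univ i))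

namespace IsSelfExcitingJumpProcess

variable (hL : IsSelfExcitingJumpProcess P 𝓕 (fun _ x => A *ᵥ (x - l₀)) B κ x₀ T X Y L)
  (hk : ∀ k x, κ k x = ν k) (hν : ∀ k, Integrable (fun x : ℝ => x ^ 2) (ν k))
include hL hk hν

theorem integrable_apply (t : ℝ≥0) (i : Fin d) : Integrable (fun ω => L t ω i) P :=
  hL.integrable_of_abs_le hk hν (p := fun v => v i) (continuous_apply i) (c := 1)
    (fun v => by rw [one_mul]; exact abs_le_momentWeight v i) t

theorem integrable_mul (t : ℝ≥0) (i j : Fin d) : Integrable (fun ω => L t ω i * L t ω j) P :=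
  hL.integrable_of_abs_le hk hν (p := fun v => v i * v j)
    ((continuous_apply i).mul (continuous_apply j)) (c := 1)
    (fun v => by rw [one_mul, abs_mul]; exact abs_mul_le_momentWeight v i j) t

theorem continuousOn_meanVector (i : Fin d) :
    ContinuousOn (fun t => meanVector P L t i) (Ici 0) := by
  set p : (Fin d → ℝ) → ℝ := fun v => (A *ᵥ (v - l₀)) i + ∑ k, ((∫ y, y ∂(ν k)) * (B i k * v k) +
      (∫ y, y ^ 2 ∂(ν k)) * (0 * v k)) with hp
  have h := fun t => hL.dynkin hk hν (f := fun v => v i) (a := fun v => (A *ᵥ (v - l₀)) i) (p := p)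
    (h := fun k _ => B i k) (c := fun _ => 0) (f₀ := x₀ i)
    (K := driftBound A l₀ + ∑ i, ∑ k, |B i k|) (by simp only [mulVec, dotProduct]; fun_prop)
    (fun _ => continuous_const) (fun v => ?_) (fun k v => ?_) (fun v => rfl) t
    (fun ω I hI => by simpa using hL.apply_eq hI i)
  -- Continuity and growth of `p` do not involve the time, so any instance of `h` provides them.
  · obtain ⟨hpc, ⟨K', hK'⟩, -⟩ := h 0
    refine continuousOn_Ici_of_eq_integral
      (fun t => hL.intervalIntegrable_expectation hk hν hpc hK' t) (c := x₀ i) fun t ht => ?_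
    have := (h t.toNNReal).2.2
    rwa [Real.coe_toNNReal t ht] at this
  · have := abs_drift_le v A l₀ (w := 1) (by simpa using one_le_momentWeight v)
      (fun m => by simpa using abs_le_momentWeight v m) i
    rw [mul_one] at this
    refine this.trans (mul_le_mul_of_nonneg_right (le_add_of_nonneg_right ?_)
      (zero_le_one.trans (one_le_momentWeight v)))
    exact Finset.sum_nonneg fun _ _ => Finset.sum_nonneg fun _ _ => abs_nonneg _
  · rw [abs_mul]
    exact mul_le_mul ((abs_entry_le_sum B i k).trans
      (le_add_of_nonneg_left (driftBound_nonneg A l₀))) (abs_le_momentWeight v k) (abs_nonneg _)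
      (add_nonneg (driftBound_nonneg A l₀)
        (Finset.sum_nonneg fun _ _ => Finset.sum_nonneg fun _ _ => abs_nonneg _))

/-- The right-hand side of the Sylvester equation, as an expectation. -/
theorem integral_generator_mul (t : ℝ) (i j : Fin d) :
    ∫ ω, ((A *ᵥ (L t.toNNReal ω - l₀)) i * L t.toNNReal ω j +
        L t.toNNReal ω i * (A *ᵥ (L t.toNNReal ω - l₀)) j +
        ∑ k, ((∫ y, y ∂(ν k)) * ((L t.toNNReal ω i * B j k + L t.toNNReal ω j * B i k) *
          L t.toNNReal ω k) + (∫ y, y ^ 2 ∂(ν k)) * (B i k * B j k * L t.toNNReal ω k))) ∂P =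
      (meanMatrix A B ν * secondMoment P L t + secondMoment P L t * (meanMatrix A B ν)ᵀ +
        sylvesterSource A B l₀ ν (meanVector P L t)) i j := by
  have h1 := hL.integrable_apply hk hν t.toNNReal
  have h2 := hL.integrable_mul hk hν t.toNNReal
  -- Pointwise generator identity: the mean jump terms join the quadratic part of the drift to form
  -- `A + BJ = M`, and the terms with `l₀` and with second jump moments are linear in `v` and form
  -- the source.
  have hpt : ∀ v : Fin d → ℝ, (A *ᵥ (v - l₀)) i * v j + v i * (A *ᵥ (v - l₀)) j +
        ∑ k, ((∫ y, y ∂(ν k)) * ((v i * B j k + v j * B i k) * v k) +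
          (∫ y, y ^ 2 ∂(ν k)) * (B i k * B j k * v k)) =
      (∑ k, meanMatrix A B ν i k * (v k * v j)) + (∑ k, meanMatrix A B ν j k * (v i * v k)) +
      ((∑ k, B i k * B j k * (∫ y, y ^ 2 ∂(ν k)) * v k) - ((A *ᵥ l₀) j * v i + (A *ᵥ l₀) i * v j))
      := by
    intro v
    have hA : ∀ i, (A *ᵥ (v - l₀)) i = (∑ k, A i k * v k) - (A *ᵥ l₀) i := by
      intro i
      rw [mulVec_sub]; rfl
    have hM : ∀ i k, meanMatrix A B ν i k = A i k + B i k * ∫ y, y ∂(ν k) := by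
      intro i k
      simp [meanMatrix, Matrix.mul_diagonal]
    have hsum : ∑ k, ((∫ y, y ∂(ν k)) * ((v i * B j k + v j * B i k) * v k) +
          (∫ y, y ^ 2 ∂(ν k)) * (B i k * B j k * v k)) =
        ∑ k, B i k * (∫ y, y ∂(ν k)) * (v k * v j) + ∑ k, B j k * (∫ y, y ∂(ν k)) * (v i * v k) +
        ∑ k, B i k * B j k * (∫ y, y ^ 2 ∂(ν k)) * v k := by
      rw [← Finset.sum_add_distrib, ← Finset.sum_add_distrib]
      exact Finset.sum_congr rfl fun k _ => by ring
    have e1 : (∑ k, A i k * v k) * v j = ∑ k, A i k * (v k * v j) := by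
      rw [Finset.sum_mul]; exact Finset.sum_congr rfl fun k _ => by ring
    have e2 : v i * (∑ k, A j k * v k) = ∑ k, A j k * (v i * v k) := by
      rw [Finset.mul_sum]; exact Finset.sum_congr rfl fun k _ => by ring
    rw [hsum]
    simp only [hA, hM, add_mul, Finset.sum_add_distrib]
    linear_combination e1 + e2
  simp only [hpt]
  have i1 : Integrable (fun ω => ∑ k, meanMatrix A B ν i k *
      (L t.toNNReal ω k * L t.toNNReal ω j)) P :=
    integrable_finsetSum _ fun k _ => (h2 k j).const_mul _
  have i2 : Integrable (fun ω => ∑ k, meanMatrix A B ν j k *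
      (L t.toNNReal ω i * L t.toNNReal ω k)) P :=
    integrable_finsetSum _ fun k _ => (h2 i k).const_mul _
  have i3 : Integrable (fun ω => ∑ k, B i k * B j k * (∫ y, y ^ 2 ∂(ν k)) *
      L t.toNNReal ω k) P :=
    integrable_finsetSum _ fun k _ => (h1 k).const_mul _
  have i12 : Integrable (fun ω => (∑ k, meanMatrix A B ν i k *
      (L t.toNNReal ω k * L t.toNNReal ω j)) + ∑ k, meanMatrix A B ν j k *
      (L t.toNNReal ω i * L t.toNNReal ω k)) P := i1.add i2
  have i4 : Integrable (fun ω => (A *ᵥ l₀) j * L t.toNNReal ω i +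
      (A *ᵥ l₀) i * L t.toNNReal ω j) P := ((h1 i).const_mul _).add ((h1 j).const_mul _)
  have i34 : Integrable (fun ω => (∑ k, B i k * B j k * (∫ y, y ^ 2 ∂(ν k)) * L t.toNNReal ω k) -
      ((A *ᵥ l₀) j * L t.toNNReal ω i + (A *ᵥ l₀) i * L t.toNNReal ω j)) P := i3.sub i4
  rw [integral_add i12 i34, integral_add i1 i2, integral_sub i3 i4,
    integral_add ((h1 i).const_mul _) ((h1 j).const_mul _),
    integral_finsetSum _ fun k _ => (h2 k j).const_mul _,
    integral_finsetSum _ fun k _ => (h2 i k).const_mul _,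
    integral_finsetSum _ fun k _ => (h1 k).const_mul _]
  simp only [integral_const_mul]
  have s1 : (meanMatrix A B ν * secondMoment P L t) i j = ∑ k, meanMatrix A B ν i k *
      ∫ ω, L t.toNNReal ω k * L t.toNNReal ω j ∂P := by
    simp [Matrix.mul_apply, secondMoment]
  have s2 : (secondMoment P L t * (meanMatrix A B ν)ᵀ) i j = ∑ k, meanMatrix A B ν j k *
      ∫ ω, L t.toNNReal ω i * L t.toNNReal ω k ∂P := by
    simp only [Matrix.mul_apply, secondMoment, Matrix.transpose_apply, Matrix.of_apply]
    exact Finset.sum_congr rfl fun k _ => mul_comm _ _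
  have s3 : sylvesterSource A B l₀ ν (meanVector P L t) i j =
      (∑ k, B i k * B j k * (∫ y, y ^ 2 ∂(ν k)) * ∫ ω, L t.toNNReal ω k ∂P) -
      ((A *ᵥ l₀) j * (∫ ω, L t.toNNReal ω i ∂P) + (A *ᵥ l₀) i * ∫ ω, L t.toNNReal ω j ∂P) := by
    simp only [sylvesterSource, jumpSecondMoment, meanVector, Matrix.add_apply, Matrix.sub_apply,
      Matrix.neg_apply, vecMulVec_apply, Matrix.mul_apply (M := B * _), Matrix.mul_diagonal,
      Matrix.transpose_apply]
    have e1 : (vecMulVec (meanVector P L t) l₀ * Aᵀ) i j =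
        (A *ᵥ l₀) j * ∫ ω, L t.toNNReal ω i ∂P := by
      simp only [meanVector, Matrix.mul_apply, vecMulVec_apply, Matrix.transpose_apply, mulVec,
        dotProduct, Finset.sum_mul]
      exact Finset.sum_congr rfl fun k _ => by ring
    have e2 : ∑ k, B i k * ((∫ ω, L t.toNNReal ω k ∂P) * ∫ y, y ^ 2 ∂(ν k)) * B j k =
        ∑ k, B i k * B j k * (∫ y, y ^ 2 ∂(ν k)) * ∫ ω, L t.toNNReal ω k ∂P :=
      Finset.sum_congr rfl fun k _ => by ring
    rw [e1, e2]
    ring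
  rw [Matrix.add_apply, Matrix.add_apply, s1, s2, s3]

/-- `dynkin` for `f v = v i * v j`: the coefficients `h` and `c` are read off from the jump of the
product in `mul_eq`, and `integral_generator_mul` evaluates the expected generator. -/
theorem secondMoment_eq_integral (i j : Fin d) : (∀ t : ℝ≥0, IntervalIntegrable (fun s =>
      (meanMatrix A B ν * secondMoment P L s + secondMoment P L s * (meanMatrix A B ν)ᵀ +
        sylvesterSource A B l₀ ν (meanVector P L s)) i j) volume 0 t) ∧
    ∀ t : ℝ, 0 ≤ t → secondMoment P L t i j = x₀ i * x₀ j + ∫ s in (0 : ℝ)..t,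
      (meanMatrix A B ν * secondMoment P L s + secondMoment P L s * (meanMatrix A B ν)ᵀ +
        sylvesterSource A B l₀ ν (meanVector P L s)) i j := by
  set β := ∑ i, ∑ k, |B i k| with hβ
  have hβ0 : 0 ≤ β := Finset.sum_nonneg fun _ _ => Finset.sum_nonneg fun _ _ => abs_nonneg _
  have hd0 := driftBound_nonneg A l₀
  set p : (Fin d → ℝ) → ℝ := fun v => ((A *ᵥ (v - l₀)) i * v j + v i * (A *ᵥ (v - l₀)) j) +
    ∑ k, ((∫ y, y ∂(ν k)) * ((v i * B j k + v j * B i k) * v k) +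
      (∫ y, y ^ 2 ∂(ν k)) * (B i k * B j k * v k)) with hp
  have hgen : ∀ s : ℝ, (∫ ω, p (L s.toNNReal ω) ∂P) =
      (meanMatrix A B ν * secondMoment P L s + secondMoment P L s * (meanMatrix A B ν)ᵀ +
        sylvesterSource A B l₀ ν (meanVector P L s)) i j :=
    fun s => hL.integral_generator_mul hk hν s i j
  have h := fun t => hL.dynkin hk hν (f := fun v => v i * v j)
    (a := fun v => (A *ᵥ (v - l₀)) i * v j + v i * (A *ᵥ (v - l₀)) j) (p := p)
    (h := fun k v => v i * B j k + v j * B i k) (c := fun k => B i k * B j k) (f₀ := x₀ i * x₀ j)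
    (K := 2 * driftBound A l₀ + 2 * β) (by simp only [mulVec, dotProduct]; fun_prop)
    (fun _ => by fun_prop) (fun v => ?_) (fun k v => ?_) (fun v => rfl) t
    (fun ω I hI => ?_)
  · obtain ⟨hpc, ⟨K', hK'⟩, -⟩ := h 0
    have hi := hL.intervalIntegrable_expectation hk hν hpc hK'
    simp only [hgen] at hi h
    refine ⟨hi, fun t ht => ?_⟩
    have := (h t.toNNReal).2.2
    rwa [Real.coe_toNNReal t ht] at this
  · have h1 := abs_drift_mul_le v A l₀ i j
    have h2 := abs_drift_mul_le v A l₀ j i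
    rw [mul_comm] at h2
    have h3 : 0 ≤ β * momentWeight v :=
      mul_nonneg hβ0 (zero_le_one.trans (one_le_momentWeight v))
    refine (abs_add_le _ _).trans ?_
    linarith
  · have hQ := zero_le_one.trans (one_le_momentWeight v)
    have h1 : |B j k * (v i * v k)| ≤ β * momentWeight v := by
      rw [abs_mul, abs_mul]
      exact mul_le_mul (abs_entry_le_sum B j k) (abs_mul_le_momentWeight v i k) (by positivity) hβ0
    have h2 : |B i k * (v j * v k)| ≤ β * momentWeight v := by
      rw [abs_mul, abs_mul]
      exact mul_le_mul (abs_entry_le_sum B i k) (abs_mul_le_momentWeight v j k) (by positivity) hβ0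
    have h3 : 0 ≤ driftBound A l₀ * momentWeight v := mul_nonneg hd0 hQ
    have e : (v i * B j k + v j * B i k) * v k = B j k * (v i * v k) + B i k * (v j * v k) := by
      ring
    rw [e]
    refine (abs_add_le _ _).trans ?_
    linarith
  · simp only [hL.mul_eq hI i j]
    congr 1
    exact Finset.sum_congr rfl fun n _ => by ring

end IsSelfExcitingJumpProcess

end Moments

theorem mainTheorem6 {d : ℕ} {Ω : Type*} {mΩ : MeasurableSpace Ω} (P : Measure Ω)
    [IsProbabilityMeasure P] (𝓕 : Filtration ℝ≥0 mΩ)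
    (A B : Matrix (Fin d) (Fin d) ℝ) (l₀ x₀ : Fin d → ℝ) (hl₀ : 0 ≤ l₀) (hx₀ : l₀ ≤ x₀)
    (κ : Fin d → Kernel (Fin d → ℝ) ℝ) (ν : Fin d → Measure ℝ)
    [∀ k, IsProbabilityMeasure (ν k)]
    (hhom : ∀ k x, κ k x = ν k)
    (hν : ∀ k, Integrable (fun x : ℝ => x ^ 2) (ν k))
    (T : ℕ → Ω → ℝ≥0∞) (X : ℕ → Ω → Fin d) (Y : ℕ → Fin d → Ω → ℝ)
    (L : ℝ≥0 → Ω → (Fin d → ℝ))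
    (hL : IsSelfExcitingJumpProcess P 𝓕 (fun _ x => A *ᵥ (x - l₀)) B κ x₀ T X Y L)
    (M : Matrix (Fin d) (Fin d) ℝ) (hM : M = meanMatrix A B ν)
    (F : ℝ → Matrix (Fin d) (Fin d) ℝ)
    (hF : F = fun t => sylvesterSource A B l₀ ν (meanVector P L t)) :
    (∀ (t : ℝ≥0) (i : Fin d), Integrable (fun ω => L t ω i) P) ∧
    (∀ (t : ℝ≥0) (i j : Fin d), Integrable (fun ω => L t ω i * L t ω j) P) ∧
    (∀ t : ℝ, 0 ≤ t →
      HasDerivWithinAt (secondMoment P L)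
        (M * secondMoment P L t + secondMoment P L t * Mᵀ + F t) (Ici 0) t) ∧
    (∀ t : ℝ, 0 ≤ t →
      (∀ i j, IntervalIntegrable
        (fun s => (NormedSpace.exp (-s • M) * F s * NormedSpace.exp (-s • Mᵀ)) i j) volume 0 t) ∧
      secondMoment P L t =
        NormedSpace.exp (t • M) *
          (vecMulVec x₀ x₀ + matrixIntegral
            (fun s => NormedSpace.exp (-s • M) * F s * NormedSpace.exp (-s • Mᵀ)) 0 t) *
          NormedSpace.exp (t • Mᵀ)) := by
  have hk : ∀ k x, κ k x = ν k := hhom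
  subst hM
  have hV0 : secondMoment P L 0 = vecMulVec x₀ x₀ := by
    ext i j
    rw [(hL.secondMoment_eq_integral hk hν i j).2 0 le_rfl, intervalIntegral.integral_same,
      add_zero, vecMulVec_apply]
  have hVc : ∀ i j, ContinuousOn (fun s => secondMoment P L s i j) (Ici 0) := fun i j =>
    continuousOn_Ici_of_eq_integral (hL.secondMoment_eq_integral hk hν i j).1
      (hL.secondMoment_eq_integral hk hν i j).2
  have hVc' : ContinuousOn (secondMoment P L) (Ici 0) :=
    continuousOn_pi.2 fun i => continuousOn_pi.2 fun j => hVc i j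
  have hyc : ContinuousOn (meanVector P L) (Ici 0) :=
    continuousOn_pi.2 fun i => hL.continuousOn_meanVector hk hν i
  have hFc : ContinuousOn F (Ici 0) := by
    have hs : Continuous (sylvesterSource A B l₀ ν) := by
      unfold sylvesterSource jumpSecondMoment
      fun_prop
    rw [hF]
    exact hs.comp_continuousOn hyc
  have hFij : ∀ i j, ContinuousOn (fun s => F s i j) (Ici 0) := fun i j =>
    continuousOn_pi.1 (continuousOn_pi.1 hFc i) j
  -- `V` and `y` being continuous, the integrand of the equation for `V` is continuous, which makes
  -- it the derivative at every `t ≥ 0`.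
  have hrhs : ContinuousOn (fun t => meanMatrix A B ν * secondMoment P L t +
      secondMoment P L t * (meanMatrix A B ν)ᵀ + F t) (Ici 0) :=
    ((continuousOn_const.mul hVc').add (hVc'.mul continuousOn_const)).add hFc
  have hderiv : ∀ t : ℝ, 0 ≤ t → HasDerivWithinAt (secondMoment P L)
      (meanMatrix A B ν * secondMoment P L t + secondMoment P L t * (meanMatrix A B ν)ᵀ + F t)
      (Ici 0) t := by
    intro t ht
    refine hasDerivWithinAt_matrix fun i j => ?_
    refine hasDerivWithinAt_Ici_of_eq_integral (c := x₀ i * x₀ j)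
      (e := fun t => (meanMatrix A B ν * secondMoment P L t +
        secondMoment P L t * (meanMatrix A B ν)ᵀ + F t) i j)
      (continuousOn_pi.1 (continuousOn_pi.1 hrhs i) j) (fun s hs => ?_) ht
    rw [(hL.secondMoment_eq_integral hk hν i j).2 s hs, hF]
  refine ⟨hL.integrable_apply hk hν, hL.integrable_mul hk hν, hderiv, fun t ht => ?_⟩
  rw [← hV0]
  exact sylvester_variation_of_constants (meanMatrix A B ν) _ F hFij hderiv t ht
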